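/- Let $N\ge 3$. Let $V:(0,+\infty)\to[0,+\infty]$ be measurable with $V\in L^1((r_1,r_2))$ for some $r_2>r_1>0$, and let $K:(0,+\infty)\to(0,+\infty)$ be measurable with $K\in L^s_{\mathrm{loc}}((0,+\infty))$ for some $s>\frac{2N}{N+2}$. Put $2^*=\frac{2N}{N-2}$, $D^{1,2}(\mathbb R^N)=\{u\in L^{2^*}(\mathbb R^N):\nabla u\in L^2(\mathbb R^N)\}$ (weak gradient), $$H^1_V=\Big\{u\in D^{1,2}(\mathbb R^N):\int_{\mathbb R^N}V(|x|)u^2\,dx<\infty\Big\},\qquad \|u\|^2=\int_{\mathbb R^N}\big(|\nabla u|^2+V(|x|)u^2\big)\,dx$$ (with the convention $\infty\cdot 0=0$), and let $H^1_{V,\mathrm r}$ be the closure in $H^1_V$ of the set of radial functions $u\in C_c^\infty(\mathbb R^N)$ such that $\int_{\mathbb R^N}V(|x|)u^2\,dx<\infty$. For $q>1$ let $L^q_K=L^q(\mathbb R^N,K(|x|)\,dx)$, and equip the space $L^{q_1}_K+L^{q_2}_K=\{u_1+u_2:u_1\in L^{q_1}_K,\ u_2\in L^{q_2}_K\}$ with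 the norm $\inf_{u_1+u_2=u}\max\{\|u_1\|_{L^{q_1}_K},\|u_2\|_{L^{q_2}_K}\}$. For $q>1$ and $R>0$, with $B_R=\{x\in\mathbb R^N:|x|<R\}$, set $$\mathcal S_0(q,R)=\sup_{u\in H^1_{V,\mathrm r},\,\|u\|=1}\int_{B_R}K(|x|)|u|^q\,dx,\qquad \mathcal S_\infty(q,R)=\sup_{u\in H^1_{V,\mathrm r},\,\|u\|=1}\int_{\mathbb R^N\setminus B_R}K(|x|)|u|^q\,dx,$$ both in $[0,+\infty]$. Let $q_1,q_2>1$. (i) If $$\mathcal S_0(q_1,R_1)<\infty\ \text{ and }\ \mathcal S_\infty(q_2,R_2)<\infty\ \text{ for some }R_1,R_2>0,\tag{S$'$}$$ then $H^1_{V,\mathrm r}$ is continuously embedded into $L^{q_1}_K+L^{q_2}_K$. (ii) If $$\lim_{R\to0^+}\mathcal S_0(q_1,R)=\lim_{R\to+\infty}\mathcal S_\infty(q_2,R)=0,\tag{S$''$}$$ then $H^1_{V,\mathrm r}$ is compactly embedded into $L^{q_1}_K+L^{q_2}_K$. (iii) If $K(|\cdot|)\in L^1(B_1)$ and $q_1\le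 q_2$, then these conditions are also necessary: if $H^1_{V,\mathrm r}$ is continuously embedded into $L^{q_1}_K+L^{q_2}_K$, then (S$'$) holds, and if it is compactly embedded there, then (S$''$) holds. -/

import Mathlib

open MeasureTheory Filter Topology
open scoped ENNReal NNReal ContDiff

noncomputable section

namespace WeightedSobolev

/-- `ℝ^N` with the Euclidean norm and Lebesgue measure. -/
abbrev Space (N : ℕ) : Type := EuclideanSpace ℝ (Fin N)

/-! ### The potentials -/

/-- Assumption `(V)` on a potential `V : (0,∞) → [0,∞]`; the values of `V` outside `(0,∞)` play
no role. Measurability is Lebesgue measurability on `(0,∞)`. -/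
structure IsPotentialV (V : ℝ → ℝ≥0∞) : Prop where
  measurable : AEMeasurable V (volume.restrict (Set.Ioi 0))
  integrable : ∃ r₁ r₂ : ℝ, 0 < r₁ ∧ r₁ < r₂ ∧ (∫⁻ r in Set.Ioo r₁ r₂, V r) < ⊤

/-- Assumption `(K)` in dimension `N` on a potential `K : (0,∞) → (0,∞)`; the values of `K`
outside `(0,∞)` play no role. Measurability is Lebesgue measurability on `(0,∞)`. -/
structure IsPotentialK (N : ℕ) (K : ℝ → ℝ) : Prop where
  measurable : AEMeasurable K (volume.restrict (Set.Ioi 0))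
  pos : ∀ r : ℝ, 0 < r → 0 < K r
  locally_memLp : ∃ s : ℝ, 2 * (N : ℝ) / ((N : ℝ) + 2) < s ∧
    ∀ a b : ℝ, 0 < a → a < b → MemLp K (ENNReal.ofReal s) (volume.restrict (Set.Icc a b))

/-! ### The space `D^{1,2}` -/

/-- `g` is the weak (distributional) gradient of `u` on `ℝ^N`. -/
structure HasWeakGradient {N : ℕ} (u : Space N → ℝ) (g : Space N → Space N) : Prop where
  locallyIntegrable : LocallyIntegrable u
  locallyIntegrable_grad : LocallyIntegrable g
  integral_eq : ∀ φ : Space N → ℝ, ContDiff ℝ ∞ φ → HasCompactSupport φ → ∀ v : Space N,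
    ∫ x, u x * fderiv ℝ φ x v = - ∫ x, inner ℝ (g x) v * φ x

open Classical in
/-- The weak gradient of `u` (unique up to null sets), and `0` if there is none. -/
def weakGrad {N : ℕ} (u : Space N → ℝ) : Space N → Space N :=
  if h : ∃ g : Space N → Space N, HasWeakGradient u g then h.choose else 0

/-- The critical Sobolev exponent `2^* = 2N/(N-2)`. -/
def critExp (N : ℕ) : ℝ := 2 * (N : ℝ) / ((N : ℝ) - 2)

/-- `u ∈ D^{1,2}(ℝ^N)`: `u ∈ L^{2^*}` has a weak gradient, and it lies in `L²`. -/
structure MemD12 {N : ℕ} (u : Space N → ℝ) : Prop where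
  memLp : MemLp u (ENNReal.ofReal (critExp N))
  exists_grad : ∃ g : Space N → Space N, HasWeakGradient u g
  memLp_grad : MemLp (weakGrad u) 2

/-! ### The energy space and its radial subspace -/

/-- `∫ V(|x|) u² dx`, with the convention `∞ * 0 = 0`. -/
def potentialEnergy {N : ℕ} (V : ℝ → ℝ≥0∞) (u : Space N → ℝ) : ℝ≥0∞ :=
  ∫⁻ x, V ‖x‖ * ‖u x‖ₑ ^ 2

/-- `u ∈ H^1_V(ℝ^N)`. -/
structure MemHV {N : ℕ} (V : ℝ → ℝ≥0∞) (u : Space N → ℝ) : Prop where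
  memD12 : MemD12 u
  energy_lt_top : potentialEnergy V u < ⊤

/-- The norm `(∫ |∇u|² + V(|x|) u² dx)^{1/2}` of `u ∈ H^1_V`. -/
def normHV {N : ℕ} (V : ℝ → ℝ≥0∞) (u : Space N → ℝ) : ℝ≥0∞ :=
  ((∫⁻ x, ‖weakGrad u x‖ₑ ^ 2) + potentialEnergy V u) ^ (1 / 2 : ℝ)

/-- `φ` is a radial function in `C_c^∞(ℝ^N)` with `∫ V(|x|) φ² dx < ∞`. -/
structure IsRadialTest {N : ℕ} (V : ℝ → ℝ≥0∞) (φ : Space N → ℝ) : Prop where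
  contDiff : ContDiff ℝ ∞ φ
  hasCompactSupport : HasCompactSupport φ
  radial : ∀ x y : Space N, ‖x‖ = ‖y‖ → φ x = φ y
  energy_lt_top : potentialEnergy V φ < ⊤

/-- `u ∈ H^1_{V,r}(ℝ^N)`: `u` lies in the closure in `H^1_V` of the radial functions in `C_c^∞`
with finite potential energy. -/
structure MemHVr {N : ℕ} (V : ℝ → ℝ≥0∞) (u : Space N → ℝ) : Prop where
  memHV : MemHV V u
  mem_closure : ∀ ε : ℝ≥0∞, 0 < ε →
    ∃ φ : Space N → ℝ, IsRadialTest V φ ∧ normHV V (fun x => u x - φ x) < ε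

/-! ### Weighted Lebesgue spaces and their sum -/

/-- The measure `K(|x|) dx` on `ℝ^N`, so that `L^q_K = L^q(weightMeasure N K)`. -/
def weightMeasure (N : ℕ) (K : ℝ → ℝ) : Measure (Space N) :=
  (volume : Measure (Space N)).withDensity (fun x => ENNReal.ofReal (K ‖x‖))

/-- `u = u₁ + u₂` almost everywhere, with `u₁ ∈ L^{q₁}_K` and `u₂ ∈ L^{q₂}_K`. -/
structure IsDecomp {N : ℕ} (K : ℝ → ℝ) (q₁ q₂ : ℝ) (u u₁ u₂ : Space N → ℝ) : Prop where
  left : MemLp u₁ (ENNReal.ofReal q₁) (weightMeasure N K)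
  right : MemLp u₂ (ENNReal.ofReal q₂) (weightMeasure N K)
  add_eq : ∀ᵐ x, u x = u₁ x + u₂ x

/-- `u ∈ L^{q₁}_K + L^{q₂}_K`. -/
def MemSum {N : ℕ} (K : ℝ → ℝ) (q₁ q₂ : ℝ) (u : Space N → ℝ) : Prop :=
  ∃ u₁ u₂ : Space N → ℝ, IsDecomp K q₁ q₂ u u₁ u₂

/-- The norm of `L^{q₁}_K + L^{q₂}_K`: the infimum of `max (‖u₁‖, ‖u₂‖)` over all decompositions
`u = u₁ + u₂`. -/
def normSum {N : ℕ} (K : ℝ → ℝ) (q₁ q₂ : ℝ) (u : Space N → ℝ) : ℝ≥0∞ :=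
  ⨅ (u₁ : Space N → ℝ) (u₂ : Space N → ℝ) (_ : IsDecomp K q₁ q₂ u u₁ u₂),
    max (eLpNorm u₁ (ENNReal.ofReal q₁) (weightMeasure N K))
      (eLpNorm u₂ (ENNReal.ofReal q₂) (weightMeasure N K))

/-! ### Embeddings -/

/-- `H^1_{V,r}(ℝ^N)` is continuously embedded into `L^{q₁}_K + L^{q₂}_K`. -/
def ContinuouslyEmbedded (N : ℕ) (V : ℝ → ℝ≥0∞) (K : ℝ → ℝ) (q₁ q₂ : ℝ) : Prop :=
  ∃ C : ℝ≥0, ∀ u : Space N → ℝ, MemHVr V u →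
    MemSum K q₁ q₂ u ∧ normSum K q₁ q₂ u ≤ C * normHV V u

/-- `H^1_{V,r}(ℝ^N)` is compactly embedded into `L^{q₁}_K + L^{q₂}_K`: the embedding is continuous
and every bounded sequence of `H^1_{V,r}` has a subsequence that converges in the sum space. -/
def CompactlyEmbedded (N : ℕ) (V : ℝ → ℝ≥0∞) (K : ℝ → ℝ) (q₁ q₂ : ℝ) : Prop :=
  ContinuouslyEmbedded N V K q₁ q₂ ∧
  ∀ u : ℕ → Space N → ℝ, (∀ n, MemHVr V (u n)) →
    (∃ M : ℝ≥0, ∀ n, normHV V (u n) ≤ M) →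
    ∃ w : Space N → ℝ, MemSum K q₁ q₂ w ∧ ∃ k : ℕ → ℕ, StrictMono k ∧
      Tendsto (fun n => normSum K q₁ q₂ (fun x => u (k n) x - w x)) atTop (𝓝 0)

/-! ### The functions `S_0` and `S_∞` -/

/-- `S_0(q,R) = sup { ∫_{B_R} K(|x|) |u|^q dx : u ∈ H^1_{V,r}, ‖u‖ = 1 }`. -/
def Szero (N : ℕ) (V : ℝ → ℝ≥0∞) (K : ℝ → ℝ) (q R : ℝ) : ℝ≥0∞ :=
  ⨆ (u : Space N → ℝ) (_ : MemHVr V u) (_ : normHV V u = 1),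
    ∫⁻ x in Metric.ball (0 : Space N) R, ENNReal.ofReal (K ‖x‖) * ‖u x‖ₑ ^ q

/-- `S_∞(q,R) = sup { ∫_{ℝ^N ∖ B_R} K(|x|) |u|^q dx : u ∈ H^1_{V,r}, ‖u‖ = 1 }`. -/
def Sinfty (N : ℕ) (V : ℝ → ℝ≥0∞) (K : ℝ → ℝ) (q R : ℝ) : ℝ≥0∞ :=
  ⨆ (u : Space N → ℝ) (_ : MemHVr V u) (_ : normHV V u = 1),
    ∫⁻ x in (Metric.ball (0 : Space N) R)ᶜ, ENNReal.ofReal (K ‖x‖) * ‖u x‖ₑ ^ q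

/-- `S_0(q₁,R₁) < ∞` and `S_∞(q₂,R₂) < ∞` for some `R₁, R₂ > 0`. -/
def CondFinite (N : ℕ) (V : ℝ → ℝ≥0∞) (K : ℝ → ℝ) (q₁ q₂ : ℝ) : Prop :=
  ∃ R₁ R₂ : ℝ, 0 < R₁ ∧ 0 < R₂ ∧ Szero N V K q₁ R₁ < ⊤ ∧ Sinfty N V K q₂ R₂ < ⊤

/-- `S_0(q₁,R) → 0` as `R → 0⁺` and `S_∞(q₂,R) → 0` as `R → +∞`. -/
def CondVanishing (N : ℕ) (V : ℝ → ℝ≥0∞) (K : ℝ → ℝ) (q₁ q₂ : ℝ) : Prop :=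
  Tendsto (fun R => Szero N V K q₁ R) (𝓝[>] 0) (𝓝 0) ∧
  Tendsto (fun R => Sinfty N V K q₂ R) atTop (𝓝 0)

end WeightedSobolev

end

open WeightedSobolev

noncomputable section

namespace WeightedSobolev

section

variable {N : ℕ}

/-! ### Weak gradients -/

/-! The theorem rests on the control of radial functions away from the origin. For a radial test
function, polar coordinates and Cauchy–Schwarz against the weight `r ^ (N - 1)` bound `|φ(r)|²` by a
multiple of `r ^ (2 - N) * ‖∇φ‖²` and give a Hölder-1/2 bound on every `[a, ∞)`, `a > 0`. Both pass
to the closure (`MemHVr.exists_radial_repr`). On an annulus a bounded family of `H^1_{V,r}` is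
therefore uniformly bounded, and `K(|x|) dx` is finite there, so only the ends `0` and `∞` matter;
these are what `Szero` and `Sinfty` measure.

Sufficiency: cutting `u` along a sphere puts the inner part in `L^{q₁}_K` and the outer part in
`L^{q₂}_K`. For compactness, an Arzelà–Ascoli argument extracts an a.e. convergent subsequence
(`tendsto_subseq_of_radialBound`); dominated convergence treats annuli, and Fatou with the vanishing
suprema treats the two ends (`tendsto_lintegral_sub_of_supOn_small`).

Necessity: smallness in the sum space forces smallness in `L^q_K(A)` on bounded sets of `H^1_{V,r}`
(`SumControls`). On `B_1` this is Hölder, the weighted measure being finite and `q₁ ≤ q₂`; off a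
ball the functions are bounded, so the power `q₂` is dominated by the power `q₁`. Scaling turns a
continuous embedding into finite suprema. If the suprema did not vanish under a compact embedding,
norm-one functions with mass on shrinking sets would have a subsequence close to one fixed function,
whose mass on those sets tends to zero. -/

theorem integrable_mul_test {u φ : Space N → ℝ} (hu : LocallyIntegrable u) (hφ : Continuous φ)
    (hc : HasCompactSupport φ) : Integrable fun x => u x * φ x := by
  have := hu.integrable_smul_left_of_hasCompactSupport hφ hc
  simpa [smul_eq_mul, mul_comm] using this

theorem locallyIntegrable_inner_const {g : Space N → Space N} (hg : LocallyIntegrable g)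
    (v : Space N) : LocallyIntegrable fun x => inner ℝ (g x) v := by
  rw [locallyIntegrable_iff] at hg ⊢
  intro k hk
  exact (hg k hk).inner_const v

theorem continuous_fderiv_apply_test {φ : Space N → ℝ} (hφ : ContDiff ℝ ∞ φ) (v : Space N) :
    Continuous fun x => fderiv ℝ φ x v :=
  (hφ.continuous_fderiv (by simp)).clm_apply continuous_const

theorem hasCompactSupport_fderiv_apply {φ : Space N → ℝ} (hc : HasCompactSupport φ)
    (v : Space N) : HasCompactSupport fun x => fderiv ℝ φ x v :=
  hc.fderiv_apply (𝕜 := ℝ) v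

/-- The fundamental lemma of the calculus of variations applies to each component of `g - h`. This
makes the choice inside `weakGrad` harmless. -/
theorem HasWeakGradient.ae_eq {u : Space N → ℝ} {g h : Space N → Space N}
    (hg : HasWeakGradient u g) (hh : HasWeakGradient u h) : g =ᵐ[volume] h := by
  have key : ∀ v : Space N, ∀ᵐ x, inner ℝ (g x - h x) v = (0 : ℝ) := by
    intro v
    have hloc : LocallyIntegrable fun x => inner ℝ (g x - h x) v :=
      locallyIntegrable_inner_const (hg.locallyIntegrable_grad.sub hh.locallyIntegrable_grad) v
    refine ae_eq_zero_of_integral_contDiff_smul_eq_zero hloc fun φ hφ hc => ?_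
    have h1 := hg.integral_eq φ hφ hc v
    have h2 := hh.integral_eq φ hφ hc v
    have e : ∀ x, φ x • (inner ℝ (g x - h x) v : ℝ)
        = inner ℝ (g x) v * φ x - inner ℝ (h x) v * φ x := by
      intro x; rw [inner_sub_left, smul_eq_mul]; ring
    simp_rw [e]
    rw [integral_sub
      (integrable_mul_test (locallyIntegrable_inner_const hg.locallyIntegrable_grad v)
        hφ.continuous hc)
      (integrable_mul_test (locallyIntegrable_inner_const hh.locallyIntegrable_grad v)
        hφ.continuous hc)]
    linarith
  have : ∀ᵐ x, ∀ i : Fin N, inner ℝ (g x - h x) (EuclideanSpace.single i (1 : ℝ)) = (0 : ℝ) :=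
    ae_all_iff.2 fun i => key _
  filter_upwards [this] with x hx
  rw [← sub_eq_zero]
  ext i
  simpa [EuclideanSpace.inner_single_right] using hx i

theorem HasWeakGradient.weakGrad_ae_eq {u : Space N → ℝ} {g : Space N → Space N}
    (hg : HasWeakGradient u g) : weakGrad u =ᵐ[volume] g := by
  have h : ∃ g : Space N → Space N, HasWeakGradient u g := ⟨g, hg⟩
  rw [weakGrad, dif_pos h]
  exact h.choose_spec.ae_eq hg

theorem hasWeakGradient_weakGrad {u : Space N → ℝ}
    (h : ∃ g : Space N → Space N, HasWeakGradient u g) : HasWeakGradient u (weakGrad u) := by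
  rw [weakGrad, dif_pos h]
  exact h.choose_spec

theorem HasWeakGradient.sub {u v : Space N → ℝ} {g h : Space N → Space N}
    (hu : HasWeakGradient u g) (hv : HasWeakGradient v h) :
    HasWeakGradient (fun x => u x - v x) (fun x => g x - h x) where
  locallyIntegrable := hu.locallyIntegrable.sub hv.locallyIntegrable
  locallyIntegrable_grad := hu.locallyIntegrable_grad.sub hv.locallyIntegrable_grad
  integral_eq φ hφ hc v' := by
    simp_rw [inner_sub_left, sub_mul]
    have hd := continuous_fderiv_apply_test hφ v'
    have hdc := hasCompactSupport_fderiv_apply hc v'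
    rw [integral_sub (integrable_mul_test hu.locallyIntegrable hd hdc)
      (integrable_mul_test hv.locallyIntegrable hd hdc),
      integral_sub
      (integrable_mul_test (locallyIntegrable_inner_const hu.locallyIntegrable_grad v')
        hφ.continuous hc)
      (integrable_mul_test (locallyIntegrable_inner_const hv.locallyIntegrable_grad v')
        hφ.continuous hc), hu.integral_eq φ hφ hc, hv.integral_eq φ hφ hc]
    ring

theorem HasWeakGradient.const_mul {u : Space N → ℝ} {g : Space N → Space N}
    (hu : HasWeakGradient u g) (c : ℝ) :
    HasWeakGradient (fun x => c * u x) (fun x => c • g x) where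
  locallyIntegrable := hu.locallyIntegrable.smul c
  locallyIntegrable_grad := hu.locallyIntegrable_grad.smul c
  integral_eq φ hφ hc v' := by
    simp_rw [real_inner_smul_left, mul_assoc]
    rw [integral_const_mul, integral_const_mul, hu.integral_eq φ hφ hc, mul_neg]

/-- The classical gradient of a smooth function is its weak gradient. -/
theorem hasWeakGradient_gradient {u : Space N → ℝ} (hu : ContDiff ℝ ∞ u) :
    HasWeakGradient u (gradient u) where
  locallyIntegrable := hu.continuous.locallyIntegrable
  locallyIntegrable_grad := by
    refine Continuous.locallyIntegrable ?_
    exact (InnerProductSpace.toDual ℝ (Space N)).symm.continuous.comp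
      (hu.continuous_fderiv (by simp))
  integral_eq φ hφ hc v := by
    simp_rw [inner_gradient_left]
    refine integral_mul_fderiv_eq_neg_fderiv_mul_of_integrable ?_ ?_ ?_ ?_ ?_
    · exact integrable_mul_test (continuous_fderiv_apply_test hu v).locallyIntegrable
        hφ.continuous hc
    · exact integrable_mul_test hu.continuous.locallyIntegrable
        (continuous_fderiv_apply_test hφ v) (hasCompactSupport_fderiv_apply hc v)
    · exact integrable_mul_test hu.continuous.locallyIntegrable hφ.continuous hc
    · exact fun x _ => (hu.differentiable (by simp)) x
    · exact fun x _ => (hφ.differentiable (by simp)) x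

open scoped Convolution in
/-- A function with vanishing weak gradient is constant. -/
theorem ae_eq_const_of_hasWeakGradient_zero {u : Space N → ℝ}
    (hu : HasWeakGradient u fun _ => 0) : ∃ c : ℝ, ∀ᵐ x, u x = c := by
  -- The radii keep the fixed ratio 2, so that the mollifications of a locally integrable function
  -- converge almost everywhere.
  let ψ : ℕ → ContDiffBump (0 : Space N) := fun n =>
    ⟨1 / ((n : ℝ) + 1), 2 / ((n : ℝ) + 1), by positivity, by gcongr; norm_num⟩
  have hlim : Tendsto (fun n => (ψ n).rOut) atTop (𝓝 0) := by
    have := (tendsto_one_div_add_atTop_nhds_zero_nat (𝕜 := ℝ)).const_mul 2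
    simpa [ψ, div_eq_mul_inv] using this
  have hae := ContDiffBump.ae_convolution_tendsto_right_of_locallyIntegrable (μ := volume)
    (K := 2) hlim (Eventually.of_forall fun n => by simp [ψ, div_eq_mul_inv]) hu.locallyIntegrable
  -- Each mollification is differentiable, and its derivative at `y` is `u` tested against the
  -- derivative of `t ↦ ψ(y - t)`, up to sign. It vanishes by hypothesis, so the mollification is
  -- constant.
  have hconst : ∀ n x, ((ψ n).normed volume ⋆[ContinuousLinearMap.lsmul ℝ ℝ, volume] u) x
      = ((ψ n).normed volume ⋆[ContinuousLinearMap.lsmul ℝ ℝ, volume] u) 0 := by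
    intro n x
    have hsm : ContDiff ℝ ∞ ((ψ n).normed (volume : Measure (Space N))) :=
      (ψ n).contDiff_normed
    have hcs : HasCompactSupport ((ψ n).normed (volume : Measure (Space N))) :=
      (ψ n).hasCompactSupport_normed
    have hd : ∀ y, HasFDerivAt
        ((ψ n).normed volume ⋆[ContinuousLinearMap.lsmul ℝ ℝ, volume] u)
        (0 : Space N →L[ℝ] ℝ) y := by
      intro y
      have h1 := hcs.hasFDerivAt_convolution_left (𝕜 := ℝ) (μ := volume)
        (ContinuousLinearMap.lsmul ℝ ℝ : ℝ →L[ℝ] ℝ →L[ℝ] ℝ)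
        (hsm.of_le (by simp)) hu.locallyIntegrable y
      suffices hz : (fderiv ℝ ((ψ n).normed volume)
          ⋆[(ContinuousLinearMap.lsmul ℝ ℝ).precompL (Space N), volume] u) y = 0 by rwa [hz] at h1
      refine ContinuousLinearMap.ext fun v => ?_
      rw [convolution_eq_swap]
      have hint : Integrable fun t => ((ContinuousLinearMap.lsmul ℝ ℝ).precompL (Space N))
          (fderiv ℝ ((ψ n).normed volume) (y - t)) (u t) := by
        have := (hcs.fderiv (𝕜 := ℝ)).convolutionExists_left
          ((ContinuousLinearMap.lsmul ℝ ℝ).precompL (Space N)) (hsm.continuous_fderiv (by simp))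
          hu.locallyIntegrable y
        exact this.integrable_swap
      rw [ContinuousLinearMap.integral_apply hint]
      have h2 := hu.integral_eq (fun t => (ψ n).normed volume (y - t))
        (hsm.comp (contDiff_const.sub contDiff_id))
        (hcs.comp_homeomorph (Homeomorph.subLeft y)) v
      have e : ∀ t, fderiv ℝ (fun t => (ψ n).normed volume (y - t)) t v
          = - fderiv ℝ ((ψ n).normed volume) (y - t) v := by
        intro t
        have := (hsm.differentiable (by simp) (y - t)).hasFDerivAt.comp t
          ((hasFDerivAt_const y t).sub (hasFDerivAt_id t))
        have h3 := this.fderiv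
        simp only [Function.comp_def] at h3
        erw [h3]
        simp
      simp_rw [e] at h2
      simp only [mul_neg, integral_neg, inner_zero_left, zero_mul, integral_zero, neg_zero,
        neg_eq_zero] at h2
      simpa [ContinuousLinearMap.precompL_apply, mul_comm] using h2
    exact is_const_of_fderiv_eq_zero (𝕜 := ℝ) (fun y => (hd y).differentiableAt)
      (fun y => (hd y).fderiv) x 0
  -- The constant is the value of `u` at any point of convergence; if there were none, the a.e.
  -- statement `hae` would make every conclusion hold.
  by_cases hex : ∃ x, Tendsto (fun n =>
      ((ψ n).normed volume ⋆[ContinuousLinearMap.lsmul ℝ ℝ, volume] u) x) atTop (𝓝 (u x))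
  · obtain ⟨x₀, hx₀⟩ := hex
    refine ⟨u x₀, ?_⟩
    filter_upwards [hae] with x hx
    simp_rw [hconst _ x] at hx
    simp_rw [hconst _ x₀] at hx₀
    exact tendsto_nhds_unique hx hx₀
  · refine ⟨0, ?_⟩
    filter_upwards [hae] with x hx
    exact absurd ⟨x, hx⟩ hex

end

section

variable {N : ℕ}

/-! ### Polar coordinates -/

/-- The area of the unit sphere of `ℝ^N`. -/
def sphereArea (N : ℕ) : ℝ≥0∞ := (volume : Measure (Space N)).toSphere Set.univ

theorem sphereArea_ne_top : sphereArea N ≠ ⊤ := measure_ne_top _ _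

theorem sphereArea_ne_zero (hN : N ≠ 0) : sphereArea N ≠ 0 := by
  have : Nontrivial (Space N) := by
    have : Nonempty (Fin N) := ⟨⟨0, Nat.pos_of_ne_zero hN⟩⟩
    infer_instance
  rw [sphereArea, Ne, Measure.measure_univ_eq_zero]
  exact Measure.toSphere_ne_zero _

theorem lintegral_fun_norm (hN : N ≠ 0) {f : ℝ → ℝ≥0∞} (hf : Measurable f) :
    ∫⁻ x : Space N, f ‖x‖
      = sphereArea N * ∫⁻ r in Set.Ioi (0 : ℝ), ENNReal.ofReal (r ^ (N - 1)) * f r := by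
  have : Nontrivial (Space N) := by
    have : Nonempty (Fin N) := ⟨⟨0, Nat.pos_of_ne_zero hN⟩⟩
    infer_instance
  calc
    ∫⁻ x : Space N, f ‖x‖ = ∫⁻ x : ({(0)}ᶜ : Set (Space N)), f ‖x.1‖ ∂(volume.comap Subtype.val) := by
      rw [lintegral_subtype_comap (measurableSet_singleton _).compl fun x : Space N ↦ f ‖x‖,
        restrict_compl_singleton]
    _ = ∫⁻ x, f x.2 ∂(volume : Measure (Space N)).toSphere.prod
          (.volumeIoiPow (Module.finrank ℝ (Space N) - 1)) := by
      simpa using (volume : Measure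
        (Space N)).measurePreserving_homeomorphUnitSphereProd.lintegral_comp_emb
        (Homeomorph.measurableEmbedding _) (f ∘ Subtype.val ∘ Prod.snd)
    _ = _ := by
      rw [lintegral_prod _ (by fun_prop)]
      simp only [lintegral_const]
      rw [mul_comm, finrank_euclideanSpace_fin, sphereArea]
      congr 1
      rw [Measure.volumeIoiPow, lintegral_withDensity_eq_lintegral_mul _ (by fun_prop)
        (by fun_prop)]
      exact lintegral_subtype_comap measurableSet_Ioi
        fun r : ℝ => ENNReal.ofReal (r ^ (N - 1)) * f r

/-- The potentials are only a.e. measurable on `(0, ∞)`. Polar coordinates show that null sets of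
radii pull back to null sets of `ℝ^N`, which makes `V(|x|)` and `K(|x|)` a.e. measurable. -/
theorem quasiMeasurePreserving_norm (hN : N ≠ 0) : Measure.QuasiMeasurePreserving
    (fun x : Space N => ‖x‖) volume (volume.restrict (Set.Ioi 0)) := by
  refine ⟨measurable_norm, Measure.AbsolutelyContinuous.mk fun s hs h0 => ?_⟩
  rw [Measure.map_apply measurable_norm hs, ← lintegral_indicator_one (measurable_norm hs)]
  have : ∀ x : Space N, ((fun x : Space N => ‖x‖) ⁻¹' s).indicator (1 : Space N → ℝ≥0∞) x
      = s.indicator 1 ‖x‖ := fun x => rfl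
  simp_rw [this]
  rw [lintegral_fun_norm hN (measurable_one.indicator hs)]
  have h1 : ∀ r, ENNReal.ofReal (r ^ (N - 1)) * s.indicator (1 : ℝ → ℝ≥0∞) r
      = s.indicator (fun r => ENNReal.ofReal (r ^ (N - 1))) r := by
    intro r; by_cases hr : r ∈ s <;> simp [hr]
  simp_rw [h1]
  rw [lintegral_indicator hs, Measure.restrict_eq_zero.2 h0]
  simp

/-! ### The weighted measure -/

theorem IsPotentialV.aemeasurable_norm {V : ℝ → ℝ≥0∞} (hN : N ≠ 0) (hV : IsPotentialV V) :
    AEMeasurable fun x : Space N => V ‖x‖ :=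
  hV.measurable.comp_quasiMeasurePreserving (quasiMeasurePreserving_norm hN)

theorem IsPotentialK.aemeasurable_norm {K : ℝ → ℝ} (hN : N ≠ 0) (hK : IsPotentialK N K) :
    AEMeasurable fun x : Space N => ENNReal.ofReal (K ‖x‖) :=
  (hK.measurable.comp_quasiMeasurePreserving (quasiMeasurePreserving_norm hN)).ennreal_ofReal

theorem weightMeasure_ac (K : ℝ → ℝ) : weightMeasure N K ≪ volume :=
  withDensity_absolutelyContinuous _ _

theorem setLIntegral_weightMeasure {K : ℝ → ℝ} (hN : N ≠ 0) (hK : IsPotentialK N K)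
    {A : Set (Space N)} (hA : MeasurableSet A) {f : Space N → ℝ≥0∞} (hf : AEMeasurable f) :
    ∫⁻ x in A, f x ∂weightMeasure N K = ∫⁻ x in A, ENNReal.ofReal (K ‖x‖) * f x := by
  rw [weightMeasure, restrict_withDensity hA, lintegral_withDensity_eq_lintegral_mul₀
    (hK.aemeasurable_norm hN).restrict hf.restrict]
  rfl

/-- Since `2N/(N+2) ≥ 1`, the local `L^s` assumption gives `L¹` on `[a, b]`, where the Jacobian is
at most `b ^ (N - 1)`. -/
theorem weightMeasure_annulus_lt_top {K : ℝ → ℝ} (hN : 3 ≤ N) (hK : IsPotentialK N K)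
    {a b : ℝ} (ha : 0 < a) (hab : a < b) :
    weightMeasure N K (Metric.ball 0 b \ Metric.ball 0 a) < ⊤ := by
  obtain ⟨s, hs, hLp⟩ := hK.locally_memLp
  have hs1 : 1 ≤ s := by
    refine le_trans ?_ hs.le
    have : (3 : ℝ) ≤ N := by exact_mod_cast hN
    rw [le_div_iff₀ (by positivity)]
    linarith
  have hint : Integrable K (volume.restrict (Set.Icc a b)) :=
    (hLp a b ha hab).integrable (by simpa using ENNReal.ofReal_le_ofReal hs1)
  -- The polar formula is stated for measurable integrands, so `K` is replaced by a measurable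
  -- version.
  set k := hint.1.mk K with hk
  have hkm : Measurable k := hint.1.stronglyMeasurable_mk.measurable
  have hkK : ∀ᵐ r ∂volume, r ∈ Set.Icc a b → K r = k r :=
    (ae_restrict_iff' measurableSet_Icc).1 hint.1.ae_eq_mk
  have hae : ∀ᵐ x : Space N, ‖x‖ ∈ Set.Icc a b → K ‖x‖ = k ‖x‖ :=
    (quasiMeasurePreserving_norm (by omega)).ae (ae_restrict_of_ae hkK)
  have hmeas : MeasurableSet (Metric.ball (0 : Space N) b \ Metric.ball 0 a) :=
    measurableSet_ball.diff measurableSet_ball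
  rw [weightMeasure, withDensity_apply _ hmeas, ← lintegral_indicator hmeas]
  set F : ℝ → ℝ≥0∞ := (Set.Icc a b).indicator fun r => ENNReal.ofReal (k r) with hF
  have hFm : Measurable F := hkm.ennreal_ofReal.indicator measurableSet_Icc
  have hle : ∫⁻ x : Space N, (Metric.ball (0 : Space N) b \ Metric.ball 0 a).indicator
      (fun x => ENNReal.ofReal (K ‖x‖)) x ≤ ∫⁻ x : Space N, F ‖x‖ := by
    refine lintegral_mono_ae ?_
    filter_upwards [hae] with x hx
    by_cases hxm : x ∈ Metric.ball (0 : Space N) b \ Metric.ball 0 a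
    · have hx' : ‖x‖ ∈ Set.Icc a b := by
        simp only [Set.mem_sdiff, mem_ball_zero_iff, not_lt] at hxm
        exact ⟨hxm.2, hxm.1.le⟩
      rw [Set.indicator_of_mem hxm, hF, Set.indicator_of_mem hx', hx hx']
    · rw [Set.indicator_of_notMem hxm]
      exact zero_le
  refine hle.trans_lt ?_
  rw [lintegral_fun_norm (by omega) hFm]
  refine ENNReal.mul_lt_top sphereArea_ne_top.lt_top ?_
  have hbd : ∀ r, ENNReal.ofReal (r ^ (N - 1)) * F r ≤
      (Set.Icc a b).indicator (fun r => ENNReal.ofReal (b ^ (N - 1)) * ENNReal.ofReal (k r)) r := by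
    intro r
    by_cases hr : r ∈ Set.Icc a b
    · simp only [hF, Set.indicator_of_mem hr]
      gcongr
      · exact ha.le.trans hr.1
      · exact hr.2
    · simp [hF, hr]
  refine (lintegral_mono hbd).trans_lt ?_
  refine (setLIntegral_le_lintegral _ _).trans_lt ?_
  rw [lintegral_indicator measurableSet_Icc, lintegral_const_mul _ hkm.ennreal_ofReal]
  refine ENNReal.mul_lt_top ENNReal.ofReal_lt_top ?_
  have : Integrable k (volume.restrict (Set.Icc a b)) := hint.congr hint.1.ae_eq_mk
  refine lt_of_le_of_lt (lintegral_mono fun r => ?_) this.2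
  exact Real.ofReal_le_enorm (k r)

end

section

variable {N : ℕ} {V : ℝ → ℝ≥0∞}

/-! ### The energy space is a linear space -/

/-- The squared norm `∫ |∇u|² + V(|x|) u² dx`. -/
def energy (V : ℝ → ℝ≥0∞) (u : Space N → ℝ) : ℝ≥0∞ :=
  (∫⁻ x, ‖weakGrad u x‖ₑ ^ 2) + potentialEnergy V u

theorem normHV_eq (u : Space N → ℝ) : normHV V u = energy V u ^ (1 / 2 : ℝ) := rfl

theorem normHV_sq (u : Space N → ℝ) : normHV V u ^ 2 = energy V u := by
  rw [normHV_eq, ← ENNReal.rpow_natCast, ← ENNReal.rpow_mul]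
  norm_num

theorem enorm_sub_sq_le {E : Type*} [SeminormedAddCommGroup E] (a b : E) :
    ‖a - b‖ₑ ^ 2 ≤ 2 * ‖a‖ₑ ^ 2 + 2 * ‖b‖ₑ ^ 2 := by
  have h : ‖a - b‖₊ ^ 2 ≤ 2 * ‖a‖₊ ^ 2 + 2 * ‖b‖₊ ^ 2 := by
    have h1 : (‖a - b‖ : ℝ) ≤ ‖a‖ + ‖b‖ := norm_sub_le a b
    rw [← NNReal.coe_le_coe]
    push_cast
    nlinarith [sq_nonneg (‖a‖ - ‖b‖), norm_nonneg (a - b), norm_nonneg a, norm_nonneg b]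
  simp only [enorm_eq_nnnorm]
  exact_mod_cast h

theorem lintegral_sq_lt_top {E : Type*} [NormedAddCommGroup E] {g : Space N → E}
    (hg : MemLp g 2) : ∫⁻ x, ‖g x‖ₑ ^ 2 < ⊤ := by
  have := lintegral_rpow_enorm_lt_top_of_eLpNorm_lt_top (p := 2) (by simp) (by simp) hg.2
  simpa using this

theorem MemD12.hasWeakGradient {u : Space N → ℝ} (hu : MemD12 u) :
    HasWeakGradient u (weakGrad u) := hasWeakGradient_weakGrad hu.exists_grad

theorem MemD12.weakGrad_sub {u v : Space N → ℝ} (hu : MemD12 u) (hv : MemD12 v) :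
    weakGrad (fun x => u x - v x) =ᵐ[volume] fun x => weakGrad u x - weakGrad v x :=
  (hu.hasWeakGradient.sub hv.hasWeakGradient).weakGrad_ae_eq

theorem MemD12.weakGrad_const_mul {u : Space N → ℝ} (hu : MemD12 u) (c : ℝ) :
    weakGrad (fun x => c * u x) =ᵐ[volume] fun x => c • weakGrad u x :=
  (hu.hasWeakGradient.const_mul c).weakGrad_ae_eq

theorem MemD12.sub {u v : Space N → ℝ} (hu : MemD12 u) (hv : MemD12 v) :
    MemD12 fun x => u x - v x where
  memLp := hu.memLp.sub hv.memLp
  exists_grad := ⟨_, hu.hasWeakGradient.sub hv.hasWeakGradient⟩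
  memLp_grad := (memLp_congr_ae (hu.weakGrad_sub hv)).2 (hu.memLp_grad.sub hv.memLp_grad)

theorem MemD12.const_mul {u : Space N → ℝ} (hu : MemD12 u) (c : ℝ) :
    MemD12 fun x => c * u x where
  memLp := hu.memLp.const_mul c
  exists_grad := ⟨_, hu.hasWeakGradient.const_mul c⟩
  memLp_grad := (memLp_congr_ae (hu.weakGrad_const_mul c)).2 (hu.memLp_grad.const_smul c)

theorem potentialEnergy_sub_le (hV : AEMeasurable fun x : Space N => V ‖x‖) {u v : Space N → ℝ}
    (hu : AEMeasurable u) : potentialEnergy V (fun x => u x - v x) ≤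
      2 * potentialEnergy V u + 2 * potentialEnergy V v := by
  unfold potentialEnergy
  calc ∫⁻ x, V ‖x‖ * ‖u x - v x‖ₑ ^ 2
      ≤ ∫⁻ x, (2 * (V ‖x‖ * ‖u x‖ₑ ^ 2) + 2 * (V ‖x‖ * ‖v x‖ₑ ^ 2)) := by
        refine lintegral_mono fun x => ?_
        calc V ‖x‖ * ‖u x - v x‖ₑ ^ 2 ≤ V ‖x‖ * (2 * ‖u x‖ₑ ^ 2 + 2 * ‖v x‖ₑ ^ 2) := by
              gcongr; exact enorm_sub_sq_le _ _
          _ = _ := by ring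
    _ = _ := by
        have hm : AEMeasurable fun x => 2 * (V ‖x‖ * ‖u x‖ₑ ^ 2) :=
          (hV.mul (hu.enorm.pow_const 2)).const_mul 2
        rw [lintegral_add_left' hm, lintegral_const_mul' _ _ (by simp), lintegral_const_mul' _ _ (by simp)]

theorem potentialEnergy_const_mul (u : Space N → ℝ) (c : ℝ) :
    potentialEnergy V (fun x => c * u x) = ‖c‖ₑ ^ 2 * potentialEnergy V u := by
  unfold potentialEnergy
  rw [← lintegral_const_mul' _ _ (by simp)]
  refine lintegral_congr fun x => ?_
  rw [enorm_mul]
  ring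

theorem energy_const_mul {u : Space N → ℝ} (hu : MemD12 u) (c : ℝ) :
    energy V (fun x => c * u x) = ‖c‖ₑ ^ 2 * energy V u := by
  rw [energy, energy, potentialEnergy_const_mul, mul_add]
  congr 1
  rw [← lintegral_const_mul' _ _ (by simp)]
  refine lintegral_congr_ae ?_
  filter_upwards [hu.weakGrad_const_mul c] with x hx
  rw [hx, enorm_smul]
  ring

theorem normHV_const_mul {u : Space N → ℝ} (hu : MemD12 u) (c : ℝ) :
    normHV V (fun x => c * u x) = ‖c‖ₑ * normHV V u := by
  rw [normHV_eq, normHV_eq, energy_const_mul hu, ENNReal.mul_rpow_of_nonneg _ _ (by norm_num),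
    ← ENNReal.rpow_natCast, ← ENNReal.rpow_mul]
  norm_num

theorem energy_sub_le (hV : AEMeasurable fun x : Space N => V ‖x‖) {u v : Space N → ℝ}
    (hu : MemD12 u) (hv : MemD12 v) :
    energy V (fun x => u x - v x) ≤ 2 * energy V u + 2 * energy V v := by
  have h1 : ∫⁻ x, ‖weakGrad (fun x => u x - v x) x‖ₑ ^ 2 ≤
      2 * (∫⁻ x, ‖weakGrad u x‖ₑ ^ 2) + 2 * ∫⁻ x, ‖weakGrad v x‖ₑ ^ 2 := by
    calc ∫⁻ x, ‖weakGrad (fun x => u x - v x) x‖ₑ ^ 2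
        ≤ ∫⁻ x, (2 * ‖weakGrad u x‖ₑ ^ 2 + 2 * ‖weakGrad v x‖ₑ ^ 2) := by
          refine lintegral_mono_ae ?_
          filter_upwards [hu.weakGrad_sub hv] with x hx
          rw [hx]
          exact enorm_sub_sq_le _ _
      _ = _ := by
          rw [lintegral_add_left' ((hu.memLp_grad.1.enorm.pow_const 2).const_mul 2),
            lintegral_const_mul' _ _ (by simp), lintegral_const_mul' _ _ (by simp)]
  have h2 := potentialEnergy_sub_le hV (u := u) (v := v) hu.memLp.1.aemeasurable
  unfold energy
  calc _ ≤ _ := add_le_add h1 h2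
    _ = _ := by ring

/-- For two functions with the same bound `M`, the crude inequality `|a - b|² ≤ 2|a|² + 2|b|²`
already yields the triangle-inequality constant, because `2M² + 2M² = (2M)²`. -/
theorem normHV_sub_le (hV : AEMeasurable fun x : Space N => V ‖x‖) {u v : Space N → ℝ}
    (hu : MemD12 u) (hv : MemD12 v) {M : ℝ≥0∞} (huM : normHV V u ≤ M) (hvM : normHV V v ≤ M) :
    normHV V (fun x => u x - v x) ≤ 2 * M := by
  rw [← ENNReal.pow_le_pow_left_iff two_ne_zero, normHV_sq]
  calc _ ≤ _ := energy_sub_le hV hu hv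
    _ = 2 * normHV V u ^ 2 + 2 * normHV V v ^ 2 := by rw [normHV_sq, normHV_sq]
    _ ≤ 2 * M ^ 2 + 2 * M ^ 2 := by gcongr
    _ = (2 * M) ^ 2 := by ring

theorem MemHV.normHV_ne_top {u : Space N → ℝ} (hu : MemHV V u) : normHV V u ≠ ⊤ := by
  refine ENNReal.rpow_ne_top_of_nonneg (by norm_num) ?_
  exact ENNReal.add_ne_top.2 ⟨(lintegral_sq_lt_top hu.memD12.memLp_grad).ne, hu.energy_lt_top.ne⟩

theorem IsRadialTest.memD12 {φ : Space N → ℝ} (hφ : IsRadialTest V φ) : MemD12 φ where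
  memLp := hφ.contDiff.continuous.memLp_of_hasCompactSupport hφ.hasCompactSupport
  exists_grad := ⟨_, hasWeakGradient_gradient hφ.contDiff⟩
  memLp_grad := by
    refine (memLp_congr_ae (hasWeakGradient_gradient hφ.contDiff).weakGrad_ae_eq).2 ?_
    refine Continuous.memLp_of_hasCompactSupport ?_ ?_
    · exact (InnerProductSpace.toDual ℝ (Space N)).symm.continuous.comp
        (hφ.contDiff.continuous_fderiv (by simp))
    · exact (hφ.hasCompactSupport.fderiv (𝕜 := ℝ)).comp_left (map_zero _)

theorem IsRadialTest.sub (hV : AEMeasurable fun x : Space N => V ‖x‖) {φ ψ : Space N → ℝ}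
    (hφ : IsRadialTest V φ) (hψ : IsRadialTest V ψ) : IsRadialTest V fun x => φ x - ψ x where
  contDiff := hφ.contDiff.sub hψ.contDiff
  hasCompactSupport := hφ.hasCompactSupport.sub hψ.hasCompactSupport
  radial x y hxy := by rw [hφ.radial x y hxy, hψ.radial x y hxy]
  energy_lt_top := by
    refine (potentialEnergy_sub_le hV hφ.contDiff.continuous.aemeasurable).trans_lt ?_
    exact ENNReal.add_lt_top.2 ⟨ENNReal.mul_lt_top (by simp) hφ.energy_lt_top,
      ENNReal.mul_lt_top (by simp) hψ.energy_lt_top⟩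

theorem IsRadialTest.const_mul {φ : Space N → ℝ} (hφ : IsRadialTest V φ) (c : ℝ) :
    IsRadialTest V fun x => c * φ x where
  contDiff := contDiff_const.mul hφ.contDiff
  hasCompactSupport := hφ.hasCompactSupport.mul_left
  radial x y hxy := by rw [hφ.radial x y hxy]
  energy_lt_top := by
    rw [potentialEnergy_const_mul]
    exact ENNReal.mul_lt_top (by simp) hφ.energy_lt_top

theorem MemHV.sub (hV : AEMeasurable fun x : Space N => V ‖x‖) {u v : Space N → ℝ}
    (hu : MemHV V u) (hv : MemHV V v) : MemHV V fun x => u x - v x where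
  memD12 := hu.memD12.sub hv.memD12
  energy_lt_top := by
    refine (potentialEnergy_sub_le hV hu.memD12.memLp.1.aemeasurable).trans_lt ?_
    exact ENNReal.add_lt_top.2 ⟨ENNReal.mul_lt_top (by simp) hu.energy_lt_top,
      ENNReal.mul_lt_top (by simp) hv.energy_lt_top⟩

theorem MemHV.const_mul {u : Space N → ℝ} (hu : MemHV V u) (c : ℝ) :
    MemHV V fun x => c * u x where
  memD12 := hu.memD12.const_mul c
  energy_lt_top := by
    rw [potentialEnergy_const_mul]
    exact ENNReal.mul_lt_top (by simp) hu.energy_lt_top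

theorem MemHVr.sub (hV : AEMeasurable fun x : Space N => V ‖x‖) {u v : Space N → ℝ}
    (hu : MemHVr V u) (hv : MemHVr V v) : MemHVr V fun x => u x - v x where
  memHV := hu.memHV.sub hV hv.memHV
  mem_closure ε hε := by
    obtain ⟨δ, hδ0, hδ⟩ := exists_between hε
    have hδ2 : 0 < δ / 2 := ENNReal.div_pos hδ0.ne' (by simp)
    obtain ⟨φ, hφ, hφu⟩ := hu.mem_closure _ hδ2
    obtain ⟨ψ, hψ, hψv⟩ := hv.mem_closure _ hδ2
    refine ⟨_, hφ.sub hV hψ, lt_of_le_of_lt ?_ hδ⟩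
    have e : (fun x => u x - v x - (φ x - ψ x)) = fun x => (u x - φ x) - (v x - ψ x) := by
      ext x; ring
    rw [e]
    refine (normHV_sub_le hV (hu.memHV.memD12.sub hφ.memD12) (hv.memHV.memD12.sub hψ.memD12)
      hφu.le hψv.le).trans ?_
    rw [ENNReal.mul_div_cancel (by simp) (by simp)]

theorem MemHVr.const_mul {u : Space N → ℝ} (hu : MemHVr V u) (c : ℝ) :
    MemHVr V fun x => c * u x where
  memHV := hu.memHV.const_mul c
  mem_closure ε hε := by
    -- Adding 1 covers the case `c = 0`.
    have hε' : 0 < ε / (‖c‖ₑ + 1) := ENNReal.div_pos hε.ne' (by simp)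
    obtain ⟨φ, hφ, hφu⟩ := hu.mem_closure _ hε'
    refine ⟨_, hφ.const_mul c, ?_⟩
    have e : (fun x => c * u x - c * φ x) = fun x => c * (u x - φ x) := by
      ext x; ring
    rw [e, normHV_const_mul (hu.memHV.memD12.sub hφ.memD12)]
    calc ‖c‖ₑ * normHV V (fun x => u x - φ x)
        ≤ (‖c‖ₑ + 1) * normHV V (fun x => u x - φ x) := by gcongr; exact le_self_add
      _ < (‖c‖ₑ + 1) * (ε / (‖c‖ₑ + 1)) := by
        exact (ENNReal.mul_lt_mul_iff_right (by simp) (by simp)).2 hφu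
      _ ≤ ε := ENNReal.mul_div_le

end

section

variable {N : ℕ} {V : ℝ → ℝ≥0∞}

/-! ### Pointwise estimates for radial functions -/

theorem lintegral_mul_sq_le {α : Type*} [MeasurableSpace α] {μ : Measure α} {f g : α → ℝ≥0∞}
    (hf : AEMeasurable f μ) (hg : AEMeasurable g μ) :
    (∫⁻ x, f x * g x ∂μ) ^ 2 ≤ (∫⁻ x, f x ^ 2 ∂μ) * ∫⁻ x, g x ^ 2 ∂μ := by
  have h := ENNReal.lintegral_mul_le_Lp_mul_Lq μ Real.HolderConjugate.two_two hf hg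
  calc (∫⁻ x, f x * g x ∂μ) ^ 2
      ≤ ((∫⁻ x, f x ^ (2 : ℝ) ∂μ) ^ (1 / 2 : ℝ) * (∫⁻ x, g x ^ (2 : ℝ) ∂μ) ^ (1 / 2 : ℝ)) ^ 2 := by
        gcongr; exact h
    _ = _ := by
        rw [mul_pow, ← ENNReal.rpow_natCast, ← ENNReal.rpow_natCast, ← ENNReal.rpow_mul,
          ← ENNReal.rpow_mul]
        norm_num

/-- The growth and Hölder bounds, away from the origin, of the profile of a radial function
with Dirichlet energy at most `G`. -/
structure RadialBound (N : ℕ) (f : ℝ → ℝ) (G : ℝ≥0∞) : Prop where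
  decay : ∀ a : ℝ, 0 < a →
    ‖f a‖ₑ ^ 2 ≤ (sphereArea N)⁻¹ * G * ENNReal.ofReal ((a ^ (N - 2))⁻¹)
  holder : ∀ a b : ℝ, 0 < a → a < b →
    ‖f b - f a‖ₑ ^ 2 ≤ (sphereArea N)⁻¹ * G * ENNReal.ofReal ((a ^ (N - 1))⁻¹ * (b - a))

/-- The profile of a radial function. -/
def profile (φ : Space (N + 1) → ℝ) (r : ℝ) : ℝ := φ (r • EuclideanSpace.single 0 1)

/-- Fundamental theorem of calculus, then Cauchy–Schwarz after writing `f' = (r^{n/2} f') ·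
r^{-n/2}`. The first factor is the radial Dirichlet energy when `n = N - 1`. -/
theorem enorm_sub_sq_le_lintegral_deriv {f : ℝ → ℝ} (hf : ContDiff ℝ 1 f) (n : ℕ) {a b : ℝ}
    (ha : 0 < a) (hab : a ≤ b) :
    ‖f b - f a‖ₑ ^ 2 ≤ (∫⁻ r in Set.Ioi (0 : ℝ), ENNReal.ofReal (r ^ n) * ‖deriv f r‖ₑ ^ 2) *
      ∫⁻ r in Set.Ioc a b, ENNReal.ofReal ((r ^ n)⁻¹) := by
  have hd : Continuous (deriv f) := hf.continuous_deriv le_rfl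
  have hftc : ∫ r in a..b, deriv f r = f b - f a :=
    intervalIntegral.integral_deriv_eq_sub (fun x _ => hf.differentiable (by simp) x)
      (hd.intervalIntegrable _ _)
  rw [intervalIntegral.integral_of_le hab] at hftc
  have h1 : ‖f b - f a‖ₑ ≤ ∫⁻ r in Set.Ioc a b, ‖deriv f r‖ₑ := by
    rw [← hftc]; exact enorm_integral_le_lintegral_enorm _
  have h2 : ∫⁻ r in Set.Ioc a b, ‖deriv f r‖ₑ = ∫⁻ r in Set.Ioc a b,
      (ENNReal.ofReal (√(r ^ n)) * ‖deriv f r‖ₑ) * ENNReal.ofReal (√(r ^ n))⁻¹ := by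
    refine setLIntegral_congr_fun measurableSet_Ioc fun r hr => ?_
    have hr0 : 0 < √(r ^ n) := Real.sqrt_pos.2 (pow_pos (ha.trans hr.1) n)
    rw [mul_right_comm, ← ENNReal.ofReal_mul hr0.le, mul_inv_cancel₀ hr0.ne']
    simp
  have hm1 : Measurable fun r : ℝ => ENNReal.ofReal (√(r ^ n)) * ‖deriv f r‖ₑ := by
    have := hd.measurable
    fun_prop
  have hm2 : Measurable fun r : ℝ => ENNReal.ofReal (√(r ^ n))⁻¹ := by fun_prop
  calc ‖f b - f a‖ₑ ^ 2 ≤ (∫⁻ r in Set.Ioc a b, ‖deriv f r‖ₑ) ^ 2 := by gcongr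
    _ ≤ _ := by
      rw [h2]
      refine (lintegral_mul_sq_le hm1.aemeasurable hm2.aemeasurable).trans ?_
      gcongr ?_ * ?_
      · refine le_trans (le_of_eq ?_) (lintegral_mono_set (s := Set.Ioc a b)
          fun r hr => ha.trans hr.1)
        refine setLIntegral_congr_fun measurableSet_Ioc fun r hr => ?_
        rw [mul_pow, ← ENNReal.ofReal_pow (by positivity),
          Real.sq_sqrt (pow_nonneg (ha.trans hr.1).le n)]
      · refine le_of_eq (setLIntegral_congr_fun measurableSet_Ioc fun r hr => ?_)
        rw [← ENNReal.ofReal_pow (by positivity), inv_pow,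
          Real.sq_sqrt (pow_nonneg (ha.trans hr.1).le n)]

theorem lintegral_inv_pow_le_mul_sub (n : ℕ) {a b : ℝ} (ha : 0 < a) :
    ∫⁻ r in Set.Ioc a b, ENNReal.ofReal ((r ^ n)⁻¹) ≤ ENNReal.ofReal ((a ^ n)⁻¹ * (b - a)) := by
  calc ∫⁻ r in Set.Ioc a b, ENNReal.ofReal ((r ^ n)⁻¹)
      ≤ ∫⁻ r in Set.Ioc a b, ENNReal.ofReal ((a ^ n)⁻¹) := by
        refine setLIntegral_mono measurable_const fun r hr => ?_
        gcongr
        exact hr.1.le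
    _ = _ := by
        rw [setLIntegral_const, Real.volume_Ioc, ENNReal.ofReal_mul (by positivity)]

/-- The exact value is `(a^{1-n} - b^{1-n})/(n-1)`, and `n - 1 ≥ 1`. The bound is uniform in `b`,
which lets the decay estimate integrate out to the edge of the support. -/
theorem lintegral_inv_pow_le {n : ℕ} {a b : ℝ} (hn : 2 ≤ n) (ha : 0 < a) (hab : a ≤ b) :
    ∫⁻ r in Set.Ioc a b, ENNReal.ofReal ((r ^ n)⁻¹) ≤ ENNReal.ofReal ((a ^ (n - 1))⁻¹) := by
  have h0 : (0 : ℝ) ∉ Set.uIcc a b := by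
    rw [Set.uIcc_of_le hab]; exact fun h => absurd h.1 (not_le.2 ha)
  have hint : IntervalIntegrable (fun r : ℝ => (r ^ n)⁻¹) volume a b := by
    have := intervalIntegral.intervalIntegrable_zpow (μ := volume) (n := -(n : ℤ)) (Or.inr h0)
    simpa using this
  have hval : ∫ r in a..b, (r ^ n)⁻¹ ≤ (a ^ (n - 1))⁻¹ := by
    have h := integral_zpow (a := a) (b := b) (n := -(n : ℤ)) (Or.inr ⟨by omega, h0⟩)
    have e : -(n : ℤ) + 1 = -((n - 1 : ℕ) : ℤ) := by omega
    rw [e] at h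
    simp only [zpow_neg, zpow_natCast] at h
    rw [h]
    have hn' : (2 : ℝ) ≤ n := by exact_mod_cast hn
    have hA : 0 < (a ^ (n - 1))⁻¹ := by positivity
    have hB : 0 < (b ^ (n - 1))⁻¹ := by have := ha.trans_le hab; positivity
    rw [div_le_iff_of_neg (by push_cast; linarith)]
    push_cast
    nlinarith
  rw [← ofReal_integral_eq_lintegral_ofReal]
  · rw [← intervalIntegral.integral_of_le hab]
    exact ENNReal.ofReal_le_ofReal hval
  · exact (intervalIntegrable_iff_integrableOn_Ioc_of_le hab).1 hint
  · filter_upwards [ae_restrict_mem measurableSet_Ioc] with r hr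
    have := ha.trans hr.1
    positivity

theorem IsRadialTest.profile_norm {φ : Space (N + 1) → ℝ} (hφ : IsRadialTest V φ)
    (x : Space (N + 1)) : profile φ ‖x‖ = φ x := by
  refine hφ.radial _ _ ?_
  simp [norm_smul]

/-- Along a ray the chain rule gives `|f'| ≤ |∇φ|`, so polar coordinates bound the weighted
one-dimensional energy of the profile by the Dirichlet energy. Decay follows by integrating from `a`
to a point where the profile vanishes, the Hölder bound by integrating over `[a, b]`. -/
theorem IsRadialTest.radialBound_profile (hN : 2 ≤ N) {φ : Space (N + 1) → ℝ}
    (hφ : IsRadialTest V φ) :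
    RadialBound (N + 1) (profile φ) (∫⁻ x, ‖weakGrad φ x‖ₑ ^ 2) := by
  have hsm : ContDiff ℝ 1 (profile φ) := by
    refine (hφ.contDiff.of_le (by simp)).comp ?_
    exact contDiff_id.smul contDiff_const
  have hray : ∀ v : Space (N + 1), ‖v‖ = 1 → profile φ = fun t => φ (t • v) := by
    intro v hv
    ext t
    refine hφ.radial _ _ ?_
    simp [norm_smul, hv]
  have hderiv : ∀ x : Space (N + 1), x ≠ 0 → ‖deriv (profile φ) ‖x‖‖ₑ ≤ ‖gradient φ x‖ₑ := by
    intro x hx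
    set v := ‖x‖⁻¹ • x with hv
    have hv1 : ‖v‖ = 1 := by simp [hv, norm_smul, hx]
    have hvx : ‖x‖ • v = x := by simp [hv, smul_smul, hx]
    have h1 : HasDerivAt (fun t : ℝ => t • v) v ‖x‖ := by
      simpa using (hasDerivAt_id ‖x‖).smul_const v
    have h2 : HasFDerivAt φ (fderiv ℝ φ x) (‖x‖ • v) := by
      rw [hvx]; exact (hφ.contDiff.differentiable (by simp) x).hasFDerivAt
    have h3 := (h2.comp_hasDerivAt ‖x‖ h1).deriv
    rw [hray v hv1]
    simp only [Function.comp_def] at h3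
    rw [h3, ← inner_gradient_left, enorm_le_iff_norm_le]
    calc ‖(inner ℝ (gradient φ x) v : ℝ)‖ ≤ ‖gradient φ x‖ * ‖v‖ := norm_inner_le_norm _ _
      _ = _ := by rw [hv1, mul_one]
  have hG : sphereArea (N + 1) *
      (∫⁻ r in Set.Ioi (0 : ℝ), ENNReal.ofReal (r ^ N) * ‖deriv (profile φ) r‖ₑ ^ 2)
      ≤ ∫⁻ x, ‖weakGrad φ x‖ₑ ^ 2 := by
    have hm : Measurable fun r => ‖deriv (profile φ) r‖ₑ ^ 2 :=
      ((hsm.continuous_deriv le_rfl).measurable.enorm).pow_const 2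
    have := lintegral_fun_norm (N := N + 1) (by omega) hm
    rw [Nat.add_sub_cancel] at this
    rw [← this]
    refine lintegral_mono_ae ?_
    have hne : ∀ᵐ x : Space (N + 1), x ≠ 0 := by simp [ae_iff]
    filter_upwards [(hasWeakGradient_gradient hφ.contDiff).weakGrad_ae_eq, hne] with x hx hx0
    rw [hx]
    gcongr
    exact hderiv x hx0
  have hS0 := sphereArea_ne_zero (N := N + 1) (by omega)
  have hG' : (∫⁻ r in Set.Ioi (0 : ℝ), ENNReal.ofReal (r ^ N) * ‖deriv (profile φ) r‖ₑ ^ 2)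
      ≤ (sphereArea (N + 1))⁻¹ * ∫⁻ x, ‖weakGrad φ x‖ₑ ^ 2 := by
    calc _ = (sphereArea (N + 1))⁻¹ * (sphereArea (N + 1) *
        (∫⁻ r in Set.Ioi (0 : ℝ), ENNReal.ofReal (r ^ N) * ‖deriv (profile φ) r‖ₑ ^ 2)) := by
          rw [← mul_assoc, ENNReal.inv_mul_cancel hS0 sphereArea_ne_top, one_mul]
      _ ≤ _ := by gcongr
  refine ⟨fun a ha => ?_, fun a b ha hab => ?_⟩
  · obtain ⟨R, hR⟩ := hφ.hasCompactSupport.isCompact.isBounded.subset_closedBall 0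
    -- The support lies in the closed ball of radius `R`, so the profile vanishes at `b`.
    set b := max a (R + 1) with hb
    have hfb : profile φ b = 0 := by
      by_contra hne
      have hmem : b • EuclideanSpace.single (0 : Fin (N + 1)) (1 : ℝ) ∈ tsupport φ :=
        subset_tsupport _ hne
      have := hR hmem
      simp only [mem_closedBall_zero_iff, norm_smul, PiLp.norm_single, norm_one,
        mul_one, Real.norm_eq_abs] at this
      linarith [le_abs_self b, le_max_right a (R + 1)]
    have := enorm_sub_sq_le_lintegral_deriv hsm N ha (le_max_left a (R + 1))
    rw [← hb, hfb, zero_sub, enorm_neg] at this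
    refine this.trans ?_
    gcongr
    exact lintegral_inv_pow_le hN ha (le_max_left _ _)
  · refine (enorm_sub_sq_le_lintegral_deriv hsm N ha hab.le).trans ?_
    gcongr
    exact lintegral_inv_pow_le_mul_sub N ha

end

section

variable {N : ℕ} {V : ℝ → ℝ≥0∞}

/-! ### The radial representative -/

theorem RadialBound.mono {f : ℝ → ℝ} {G G' : ℝ≥0∞} (h : RadialBound N f G) (hG : G ≤ G') :
    RadialBound N f G' where
  decay a ha := (h.decay a ha).trans (by gcongr)
  holder a b ha hab := (h.holder a b ha hab).trans (by gcongr)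

theorem RadialBound.of_tendsto (hN : N ≠ 0) {f : ℕ → ℝ → ℝ} {g : ℝ → ℝ} {G : ℕ → ℝ≥0∞} {G' : ℝ≥0∞}
    (h : ∀ n, RadialBound N (f n) (G n)) (hG : Tendsto G atTop (𝓝 G'))
    (hfg : ∀ a, 0 < a → Tendsto (fun n => f n a) atTop (𝓝 (g a))) : RadialBound N g G' := by
  have hS : (sphereArea N)⁻¹ ≠ ⊤ := ENNReal.inv_ne_top.2 (sphereArea_ne_zero hN)
  have hR : ∀ t : ℝ, Tendsto (fun n => (sphereArea N)⁻¹ * G n * ENNReal.ofReal t) atTop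
      (𝓝 ((sphereArea N)⁻¹ * G' * ENNReal.ofReal t)) := fun t =>
    ENNReal.Tendsto.mul_const (ENNReal.Tendsto.const_mul hG (Or.inr hS))
      (Or.inr ENNReal.ofReal_ne_top)
  refine ⟨fun a ha => ?_, fun a b ha hab => ?_⟩
  · exact le_of_tendsto_of_tendsto' (((ENNReal.continuous_pow 2).tendsto _).comp
      ((continuous_enorm.tendsto _).comp (hfg a ha))) (hR _) fun n => (h n).decay a ha
  · exact le_of_tendsto_of_tendsto' (((ENNReal.continuous_pow 2).tendsto _).comp
      ((continuous_enorm.tendsto _).comp ((hfg b (ha.trans hab)).sub (hfg a ha)))) (hR _)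
      fun n => (h n).holder a b ha hab

/-- After multiplication by the Jacobian `y ^ (N - 1)` the integrand is just `y`. -/
theorem locallyIntegrable_inv_norm_pow (hN : 2 ≤ N) :
    LocallyIntegrable fun x : Space N => (‖x‖ ^ (N - 2))⁻¹ := by
  have : Nontrivial (Space N) := by
    have : Nonempty (Fin N) := ⟨⟨0, by omega⟩⟩
    infer_instance
  have hball : ∀ r : ℝ, IntegrableOn (fun x : Space N => (‖x‖ ^ (N - 2))⁻¹) (Metric.ball 0 r) := by
    intro r
    refine (integrableOn_fun_norm_addHaar (volume : Measure (Space N))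
      (f := fun t => (t ^ (N - 2))⁻¹)).2 ?_
    have h1 : IntegrableOn (fun y : ℝ => y) (Set.Ioo 0 r) :=
      (continuous_id.integrableOn_Icc (a := 0) (b := r)).mono_set Set.Ioo_subset_Icc_self
    refine h1.congr_fun (fun y hy => ?_) measurableSet_Ioo
    have hy0 : y ≠ 0 := hy.1.ne'
    have e : Module.finrank ℝ (Space N) - 1 = (N - 2) + 1 := by
      rw [finrank_euclideanSpace_fin]; omega
    rw [e, smul_eq_mul, pow_succ]
    field_simp
  rw [locallyIntegrable_iff]
  intro k hk
  obtain ⟨R, hR⟩ := hk.isBounded.subset_ball 0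
  exact (hball R).mono_set hR

/-- A constant which is the difference of an `L^p` function and of one that tends to zero at
infinity vanishes. -/
theorem const_eq_zero_of_memLp (hN : N ≠ 0) {p : ℝ≥0∞} (hp0 : p ≠ 0) (hp : p ≠ ⊤)
    {u w : Space N → ℝ} {c : ℝ} (hu : MemLp u p) (hc : ∀ᵐ x, u x - w x = c)
    (hw : ∀ ε > 0, ∃ R, ∀ x, R ≤ ‖x‖ → |w x| ≤ ε) : c = 0 := by
  have : Nontrivial (Space N) := by
    have : Nonempty (Fin N) := ⟨⟨0, Nat.pos_of_ne_zero hN⟩⟩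
    infer_instance
  by_contra hne
  have hc0 : 0 < |c| / 2 := by positivity
  obtain ⟨R, hR⟩ := hw _ hc0
  have hfin : volume {x | ENNReal.ofReal (|c| / 2) ≤ ‖u x‖ₑ} < ⊤ :=
    hu.meas_ge_lt_top' hp0 hp (by simpa using hc0)
  -- If `c ≠ 0`, then `|u| ≥ |c|/2` off a ball, a set of infinite measure, against Chebyshev's
  -- inequality.
  have hsub : (Metric.ball (0 : Space N) R)ᶜ ≤ᵐ[volume] {x | ENNReal.ofReal (|c| / 2) ≤ ‖u x‖ₑ} := by
    filter_upwards [hc] with x hx hxR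
    have hxR' : R ≤ ‖x‖ := not_lt.1 fun h => hxR (mem_ball_zero_iff.2 h)
    have h1 := hR x hxR'
    change ENNReal.ofReal (|c| / 2) ≤ ‖u x‖ₑ
    rw [← ofReal_norm]
    refine ENNReal.ofReal_le_ofReal ?_
    have h2 : |c| ≤ |u x| + |w x| := by rw [← hx]; exact abs_sub _ _
    rw [Real.norm_eq_abs]
    linarith
  have h3 : volume (Metric.ball (0 : Space N) R)ᶜ < ⊤ := (measure_mono_ae hsub).trans_lt hfin
  have h4 : volume (Set.univ : Set (Space N)) < ⊤ := by
    rw [← Set.union_compl_self (Metric.ball (0 : Space N) R)]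
    exact (measure_union_le _ _).trans_lt (ENNReal.add_lt_top.2 ⟨measure_ball_lt_top, h3⟩)
  rw [measure_univ_of_isAddLeftInvariant] at h4
  exact lt_irrefl _ h4

/-- Integration by parts moves the derivative onto `w n`, and Cauchy–Schwarz finishes. Convergence
of the gradients thus passes to the functions in the distributional sense without the Sobolev
inequality. -/
theorem MemD12.tendsto_integral_mul_fderiv {w : ℕ → Space N → ℝ} (hw : ∀ n, MemD12 (w n))
    (hlim : Tendsto (fun n => ∫⁻ x, ‖weakGrad (w n) x‖ₑ ^ 2) atTop (𝓝 0))
    {ψ : Space N → ℝ} (hψ : ContDiff ℝ ∞ ψ) (hc : HasCompactSupport ψ) (v : Space N) :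
    Tendsto (fun n => ∫ x, w n x * fderiv ℝ ψ x v) atTop (𝓝 0) := by
  have hbd : ∀ n, ‖∫ x, w n x * fderiv ℝ ψ x v‖ₑ ^ 2 ≤
      (∫⁻ x, ‖weakGrad (w n) x‖ₑ ^ 2) * ∫⁻ x, (‖v‖ₑ * ‖ψ x‖ₑ) ^ 2 := by
    intro n
    rw [(hw n).hasWeakGradient.integral_eq ψ hψ hc v, enorm_neg]
    calc ‖∫ x, inner ℝ (weakGrad (w n) x) v * ψ x‖ₑ ^ 2
        ≤ (∫⁻ x, ‖weakGrad (w n) x‖ₑ * (‖v‖ₑ * ‖ψ x‖ₑ)) ^ 2 := by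
          gcongr
          refine (enorm_integral_le_lintegral_enorm _).trans (lintegral_mono fun x => ?_)
          rw [enorm_mul, ← mul_assoc]
          gcongr
          rw [← ofReal_norm, ← ofReal_norm, ← ofReal_norm,
            ← ENNReal.ofReal_mul (norm_nonneg _)]
          exact ENNReal.ofReal_le_ofReal (norm_inner_le_norm _ _)
      _ ≤ _ := lintegral_mul_sq_le (hw n).memLp_grad.1.enorm
          (hψ.continuous.aemeasurable.enorm.const_mul _)
  have hfin : ∫⁻ x, (‖v‖ₑ * ‖ψ x‖ₑ) ^ 2 ≠ ⊤ := by
    simp_rw [mul_pow]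
    rw [lintegral_const_mul' _ _ (by simp)]
    exact ENNReal.mul_ne_top (by simp)
      (lintegral_sq_lt_top (hψ.continuous.memLp_of_hasCompactSupport hc)).ne
  have h0 : Tendsto (fun n => ‖∫ x, w n x * fderiv ℝ ψ x v‖ₑ ^ 2) atTop (𝓝 0) := by
    refine tendsto_of_tendsto_of_tendsto_of_le_of_le tendsto_const_nhds ?_ (fun _ => zero_le) hbd
    simpa using ENNReal.Tendsto.mul_const hlim (Or.inr hfin)
  have h1 : Tendsto (fun n => (‖∫ x, w n x * fderiv ℝ ψ x v‖ₑ ^ 2) ^ (1 / 2 : ℝ)) atTop (𝓝 0) := by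
    simpa using h0.ennrpow_const (1 / 2 : ℝ)
  rw [tendsto_zero_iff_enorm_tendsto_zero]
  refine h1.congr fun n => ?_
  rw [← ENNReal.rpow_natCast, ← ENNReal.rpow_mul]
  norm_num

/-- The decay bound applied to differences of approximating test functions makes their profiles
Cauchy at each radius, and the limit `f` inherits both bounds. The approximations converge to `u`
only in energy, so `u = f(|x|)` needs an argument: the difference has zero weak gradient, hence is
constant, and the constant is 0 because `u ∈ L^{2^*}` while `f` decays. The factor 2 comes from the
crude triangle inequality for the energy. -/
theorem MemHVr.exists_radial_repr (hN : 3 ≤ N) (hV : AEMeasurable fun x : Space N => V ‖x‖)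
    {u : Space N → ℝ} (hu : MemHVr V u) :
    ∃ f : ℝ → ℝ, (∀ᵐ x, u x = f ‖x‖) ∧ RadialBound N f (2 * energy V u) := by
  -- A dimension of the form `m + 1` supplies the basis vector used in `profile`; from here on `N`
  -- is one less than the dimension.
  obtain ⟨N, rfl⟩ : ∃ m, N = m + 1 := ⟨N - 1, by omega⟩
  have hD := hu.memHV.memD12
  set δ : ℕ → ℝ≥0∞ := fun n => ((n : ℝ≥0∞) + 1)⁻¹ with hδ
  have hδ0 : Tendsto δ atTop (𝓝 0) := by
    have := (tendsto_add_atTop_iff_nat 1).2 ENNReal.tendsto_inv_nat_nhds_zero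
    simpa [hδ] using this
  have hδ2 : Tendsto (fun n => δ n ^ 2) atTop (𝓝 0) := by
    simpa [Function.comp_def] using ((ENNReal.continuous_pow 2).tendsto 0).comp hδ0
  have hpos : ∀ n, 0 < δ n := fun n => by simp [hδ]
  choose φ hφ hφu using fun n => hu.mem_closure (δ n) (hpos n)
  have hE : ∀ n, energy V (fun x => u x - φ n x) ≤ δ n ^ 2 := by
    intro n
    rw [← normHV_sq]
    gcongr
    exact (hφu n).le
  have hbound : ∀ n, RadialBound (N + 1) (profile (φ n)) (2 * energy V u + 2 * δ n ^ 2) := by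
    intro n
    refine ((hφ n).radialBound_profile (by omega)).mono ?_
    have e : φ n = fun x => u x - (u x - φ n x) := by ext x; ring
    calc ∫⁻ x, ‖weakGrad (φ n) x‖ₑ ^ 2 ≤ energy V (φ n) := le_self_add
      _ = energy V (fun x => u x - (u x - φ n x)) := by rw [← e]
      _ ≤ _ := energy_sub_le hV hD (hD.sub (hφ n).memD12)
      _ ≤ _ := by gcongr; exact hE n
  have hdiff : ∀ n m, RadialBound (N + 1) (fun r => profile (φ n) r - profile (φ m) r)
      (2 * δ m ^ 2 + 2 * δ n ^ 2) := by
    intro n m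
    refine (((hφ n).sub hV (hφ m)).radialBound_profile (by omega)).mono ?_
    have e : (fun x => φ n x - φ m x) = fun x => (u x - φ m x) - (u x - φ n x) := by
      ext x; ring
    calc ∫⁻ x, ‖weakGrad (fun x => φ n x - φ m x) x‖ₑ ^ 2
        ≤ energy V (fun x => φ n x - φ m x) := le_self_add
      _ = energy V (fun x => (u x - φ m x) - (u x - φ n x)) := by rw [← e]
      _ ≤ _ := energy_sub_le hV (hD.sub (hφ m).memD12) (hD.sub (hφ n).memD12)
      _ ≤ _ := by gcongr <;> exact hE _
  have hcauchy : ∀ a, 0 < a → ∃ y, Tendsto (fun n => profile (φ n) a) atTop (𝓝 y) := by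
    intro a ha
    refine cauchySeq_tendsto_of_complete ?_
    have hlim : Tendsto (fun p : ℕ × ℕ => (sphereArea (N + 1))⁻¹ *
        (2 * δ p.2 ^ 2 + 2 * δ p.1 ^ 2) * ENNReal.ofReal ((a ^ (N + 1 - 2))⁻¹))
        (atTop ×ˢ atTop) (𝓝 0) := by
      have h2 : Tendsto (fun p : ℕ × ℕ => 2 * δ p.2 ^ 2 + 2 * δ p.1 ^ 2)
          (atTop ×ˢ atTop) (𝓝 0) := by
        have hA : Tendsto (fun p : ℕ × ℕ => 2 * δ p.2 ^ 2) (atTop ×ˢ atTop) (𝓝 (2 * 0)) :=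
          ENNReal.Tendsto.const_mul (hδ2.comp tendsto_snd) (Or.inr (by simp))
        have hB : Tendsto (fun p : ℕ × ℕ => 2 * δ p.1 ^ 2) (atTop ×ˢ atTop) (𝓝 (2 * 0)) :=
          ENNReal.Tendsto.const_mul (hδ2.comp tendsto_fst) (Or.inr (by simp))
        simpa using hA.add hB
      have := ENNReal.Tendsto.mul_const (b := ENNReal.ofReal ((a ^ (N + 1 - 2))⁻¹))
        (ENNReal.Tendsto.const_mul (a := (sphereArea (N + 1))⁻¹) h2
          (Or.inr (ENNReal.inv_ne_top.2 (sphereArea_ne_zero (by omega)))))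
        (Or.inr ENNReal.ofReal_ne_top)
      simpa using this
    rw [EMetric.cauchySeq_iff]
    intro ε hε
    have hev := hlim.eventually_lt_const (show (0 : ℝ≥0∞) < ε ^ 2 by positivity)
    rw [prod_atTop_atTop_eq, eventually_atTop] at hev
    obtain ⟨⟨n₁, n₂⟩, hn⟩ := hev
    refine ⟨max n₁ n₂, fun m hm n hn' => ?_⟩
    have h1 := hn (m, n) ⟨(le_max_left _ _).trans hm, (le_max_right _ _).trans hn'⟩
    have h3 := ((hdiff m n).decay a ha).trans_lt h1
    rw [edist_eq_enorm_sub]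
    exact lt_of_pow_lt_pow_left' 2 h3
  choose! f hf using hcauchy
  have hfb : RadialBound (N + 1) f (2 * energy V u) := by
    refine RadialBound.of_tendsto (by omega) hbound ?_ hf
    have := ENNReal.Tendsto.const_mul (a := 2) hδ2 (Or.inr (by simp))
    simpa using tendsto_const_nhds.add this
  refine ⟨f, ?_, hfb⟩
  have hne : ∀ᵐ x : Space (N + 1), x ≠ 0 := by simp [ae_iff]
  have hptw : ∀ᵐ x : Space (N + 1), Tendsto (fun n => φ n x) atTop (𝓝 (f ‖x‖)) := by
    filter_upwards [hne] with x hx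
    refine (hf ‖x‖ (norm_pos_iff.2 hx)).congr fun n => ?_
    exact (hφ n).profile_norm x
  -- a common local majorant
  have hfin : (sphereArea (N + 1))⁻¹ * (2 * energy V u + 2) ≠ ⊤ := by
    refine ENNReal.mul_ne_top (ENNReal.inv_ne_top.2 (sphereArea_ne_zero (by omega))) ?_
    rw [← normHV_sq]
    have := hu.memHV.normHV_ne_top
    finiteness
  -- The summand 2 absorbs `2 * δ n ^ 2`, so a single `C` serves all `φ n` and `f`.
  set C : ℝ := ((sphereArea (N + 1))⁻¹ * (2 * energy V u + 2)).toReal with hC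
  have hC0 : 0 ≤ C := ENNReal.toReal_nonneg
  have habs : ∀ {g : ℝ → ℝ} {G : ℝ≥0∞}, RadialBound (N + 1) g G → G ≤ 2 * energy V u + 2 →
      ∀ a, 0 < a → (g a) ^ 2 ≤ C * (a ^ (N - 1))⁻¹ := by
    intro g G hg hG a ha
    have h1 := hg.decay a ha
    rw [show N + 1 - 2 = N - 1 by omega] at h1
    have h2 : ‖g a‖ₑ ^ 2 ≤ ENNReal.ofReal (C * (a ^ (N - 1))⁻¹) := by
      rw [ENNReal.ofReal_mul hC0, hC, ENNReal.ofReal_toReal hfin]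
      exact h1.trans (by gcongr)
    rw [← ofReal_norm, ← ENNReal.ofReal_pow (norm_nonneg _),
      ENNReal.ofReal_le_ofReal_iff (by positivity), Real.norm_eq_abs, sq_abs] at h2
    exact h2
  have hle1 : ∀ {s : ℝ}, |s| ≤ 1 + s ^ 2 := by
    intro s
    nlinarith [sq_nonneg (|s| - 1), sq_abs s, abs_nonneg s]
  have hδ1 : ∀ n, δ n ≤ 1 := fun n => by simp [hδ]
  have hmaj : ∀ n x, x ≠ 0 → |φ n x| ≤ 1 + C * (‖x‖ ^ (N - 1))⁻¹ := by
    intro n x hx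
    rw [← (hφ n).profile_norm x]
    refine hle1.trans ?_
    gcongr
    refine habs (hbound n) ?_ _ (norm_pos_iff.2 hx)
    gcongr
    calc 2 * δ n ^ 2 ≤ 2 * 1 ^ 2 := by gcongr; exact hδ1 n
      _ = 2 := by norm_num
  have hmajf : ∀ x : Space (N + 1), x ≠ 0 → |f ‖x‖| ≤ 1 + C * (‖x‖ ^ (N - 1))⁻¹ := by
    intro x hx
    refine hle1.trans ?_
    gcongr
    exact habs hfb le_self_add _ (norm_pos_iff.2 hx)
  have hloc : LocallyIntegrable fun x : Space (N + 1) => 1 + C * (‖x‖ ^ (N - 1))⁻¹ := by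
    have h1 := locallyIntegrable_inv_norm_pow (N := N + 1) (by omega)
    exact (locallyIntegrable_const (1 : ℝ)).add (h1.smul C)
  have hfm : AEStronglyMeasurable (fun x : Space (N + 1) => f ‖x‖) volume :=
    aestronglyMeasurable_of_tendsto_ae atTop
      (fun n => (hφ n).contDiff.continuous.aestronglyMeasurable) hptw
  have hfloc : LocallyIntegrable fun x : Space (N + 1) => f ‖x‖ := by
    refine hloc.mono hfm ?_
    filter_upwards [hne] with x hx
    rw [Real.norm_eq_abs, Real.norm_eq_abs]
    exact (hmajf x hx).trans (le_abs_self _)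
  have huloc : LocallyIntegrable u := hD.hasWeakGradient.locallyIntegrable
  -- The integrals of `u - φ n` against a derivative of a test function tend to 0 because the
  -- gradients do, and to the integral for `u - f` by dominated convergence.
  have hzero : HasWeakGradient (fun x => u x - f ‖x‖) fun _ => 0 := by
    refine ⟨huloc.sub hfloc, locallyIntegrable_zero, fun ψ hψ hc v => ?_⟩
    simp only [inner_zero_left, zero_mul, integral_zero, neg_zero]
    have hd := continuous_fderiv_apply_test hψ v
    have hdc := hasCompactSupport_fderiv_apply hc v
    have h1 : Tendsto (fun n => ∫ x, (u x - φ n x) * fderiv ℝ ψ x v) atTop (𝓝 0) := by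
      refine MemD12.tendsto_integral_mul_fderiv (fun n => hD.sub (hφ n).memD12) ?_ hψ hc v
      refine tendsto_of_tendsto_of_tendsto_of_le_of_le tendsto_const_nhds hδ2
        (fun _ => zero_le) fun n => ?_
      exact le_self_add.trans (hE n)
    have h2 : Tendsto (fun n => ∫ x, (u x - φ n x) * fderiv ℝ ψ x v) atTop
        (𝓝 (∫ x, (u x - f ‖x‖) * fderiv ℝ ψ x v)) := by
      refine tendsto_integral_of_dominated_convergence
        (fun x => ‖(|u x| + (1 + C * (‖x‖ ^ (N - 1))⁻¹)) * fderiv ℝ ψ x v‖) (fun n => ?_) ?_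
        (fun n => ?_) ?_
      · exact (hD.memLp.1.sub (hφ n).contDiff.continuous.aestronglyMeasurable).mul
          hd.aestronglyMeasurable
      · refine (integrable_mul_test ?_ hd hdc).norm
        exact LocallyIntegrable.add (huloc.mono hD.memLp.1.norm (by simp)) hloc
      · filter_upwards [hne] with x hx
        rw [norm_mul, norm_mul]
        gcongr
        rw [Real.norm_eq_abs, Real.norm_eq_abs]
        refine (abs_sub _ _).trans (le_trans ?_ (le_abs_self _))
        gcongr
        exact hmaj n x hx
      · filter_upwards [hptw] with x hx
        exact (tendsto_const_nhds.sub hx).mul_const _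
    exact tendsto_nhds_unique h2 h1
  obtain ⟨c, hc⟩ := ae_eq_const_of_hasWeakGradient_zero hzero
  have hcrit : 0 < critExp (N + 1) := by
    unfold critExp
    have : (3 : ℝ) ≤ ((N + 1 : ℕ) : ℝ) := by exact_mod_cast hN
    exact div_pos (by linarith) (by linarith)
  have hc0 : c = 0 := by
    refine const_eq_zero_of_memLp (by omega) (by simpa using hcrit) (by simp) hD.memLp hc ?_
    intro ε hε
    refine ⟨max 1 (C / ε ^ 2), fun x hx => ?_⟩
    have hx1 : 1 ≤ ‖x‖ := (le_max_left _ _).trans hx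
    have hx2 : C / ε ^ 2 ≤ ‖x‖ := (le_max_right _ _).trans hx
    have h3 := habs hfb le_self_add ‖x‖ (by linarith)
    refine abs_le_of_sq_le_sq' ?_ hε.le |> abs_le.2
    refine h3.trans ?_
    have h4 : ‖x‖ ≤ ‖x‖ ^ (N - 1) := le_self_pow₀ hx1 (by omega)
    rw [← div_eq_mul_inv, div_le_iff₀ (by positivity)]
    rw [div_le_iff₀ (by positivity)] at hx2
    nlinarith [sq_nonneg ε]
  filter_upwards [hc] with x hx
  linarith

end

section

variable {N : ℕ} {V : ℝ → ℝ≥0∞} {K : ℝ → ℝ} {q q₁ q₂ : ℝ}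

/-! ### Consequences of the radial estimates -/

theorem MemHVr.aestronglyMeasurable {u : Space N → ℝ} (hu : MemHVr V u) :
    AEStronglyMeasurable u volume := hu.memHV.memD12.memLp.1

/-- The constant of the decay estimate outside the ball of radius `a`. -/
def decayConst (N : ℕ) (a : ℝ) : ℝ≥0∞ :=
  ((sphereArea N)⁻¹ * 2 * ENNReal.ofReal ((a ^ (N - 2))⁻¹)) ^ (1 / 2 : ℝ)

theorem decayConst_ne_top (hN : N ≠ 0) (a : ℝ) : decayConst N a ≠ ⊤ := by
  refine ENNReal.rpow_ne_top_of_nonneg (by norm_num) ?_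
  have := ENNReal.inv_ne_top.2 (sphereArea_ne_zero hN)
  finiteness

theorem MemHVr.ae_enorm_le (hN : 3 ≤ N) (hV : AEMeasurable fun x : Space N => V ‖x‖)
    {u : Space N → ℝ} (hu : MemHVr V u) {a : ℝ} (ha : 0 < a) :
    ∀ᵐ x, a ≤ ‖x‖ → ‖u x‖ₑ ≤ decayConst N a * normHV V u := by
  obtain ⟨f, hf, hb⟩ := hu.exists_radial_repr hN hV
  filter_upwards [hf] with x hx hax
  rw [hx, ← ENNReal.pow_le_pow_left_iff two_ne_zero, mul_pow, normHV_sq, decayConst,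
    ← ENNReal.rpow_natCast, ← ENNReal.rpow_natCast, ← ENNReal.rpow_mul]
  norm_num
  refine (hb.decay ‖x‖ (ha.trans_le hax)).trans ?_
  calc (sphereArea N)⁻¹ * (2 * energy V u) * ENNReal.ofReal ((‖x‖ ^ (N - 2))⁻¹)
      ≤ (sphereArea N)⁻¹ * (2 * energy V u) * ENNReal.ofReal ((a ^ (N - 2))⁻¹) := by gcongr
    _ = _ := by
      simp only [ENNReal.ofReal_inv_of_pos (pow_pos ha _)]
      ring

/-- The decay bound has a vanishing right side at every radius. This treats the one case that
normalising to norm 1 cannot reach. -/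
theorem MemHVr.ae_eq_zero (hN : 3 ≤ N) (hV : AEMeasurable fun x : Space N => V ‖x‖)
    {u : Space N → ℝ} (hu : MemHVr V u) (h0 : normHV V u = 0) : ∀ᵐ x, u x = 0 := by
  obtain ⟨f, hf, hb⟩ := hu.exists_radial_repr hN hV
  have hne : ∀ᵐ x : Space N, x ≠ 0 := by
    have : Nontrivial (Space N) := by
      have : Nonempty (Fin N) := ⟨⟨0, by omega⟩⟩
      infer_instance
    simp [ae_iff]
  filter_upwards [hf, hne] with x hx hx0
  have := hb.decay ‖x‖ (norm_pos_iff.2 hx0)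
  rw [← normHV_sq, h0] at this
  rw [hx]
  simpa using this

/-- An Arzelà–Ascoli argument: decay confines the values at positive rationals to compact intervals,
Tychonoff extracts a subsequence converging at all of them, and the Hölder bound, uniform in `n`,
carries convergence to every positive radius. -/
theorem tendsto_subseq_of_radialBound {f : ℕ → ℝ → ℝ} {G : ℝ≥0∞} (hN : N ≠ 0) (hG : G ≠ ⊤)
    (hf : ∀ n, RadialBound N (f n) G) :
    ∃ k : ℕ → ℕ, StrictMono k ∧ ∃ g : ℝ → ℝ, ∀ a, 0 < a →
      Tendsto (fun n => f (k n) a) atTop (𝓝 (g a)) := by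
  have hSG : (sphereArea N)⁻¹ * G ≠ ⊤ := by
    have := ENNReal.inv_ne_top.2 (sphereArea_ne_zero hN)
    finiteness
  set C : ℝ := ((sphereArea N)⁻¹ * G).toReal with hC
  have hC0 : 0 ≤ C := ENNReal.toReal_nonneg
  have hsq : ∀ {s t : ℝ}, 0 ≤ t → ‖s‖ₑ ^ 2 ≤ (sphereArea N)⁻¹ * G * ENNReal.ofReal t →
      s ^ 2 ≤ C * t := by
    intro s t ht h
    rw [← ENNReal.ofReal_toReal hSG, ← hC, ← ENNReal.ofReal_mul hC0, ← ofReal_norm,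
      ← ENNReal.ofReal_pow (norm_nonneg _), ENNReal.ofReal_le_ofReal_iff (by positivity),
      Real.norm_eq_abs, sq_abs] at h
    exact h
  -- From `|s| ≤ 1 + s²`. Nonpositive rationals carry the dummy value 0 in `X`, and `|b p|` keeps
  -- their intervals nonempty.
  let b : ℚ → ℝ := fun p => 1 + C * ((p : ℝ) ^ (N - 2))⁻¹
  let X : ℕ → ℚ → ℝ := fun n p => if (0 : ℝ) < p then f n p else 0
  have hcpt : IsCompact (Set.univ.pi fun p : ℚ => Set.Icc (-|b p|) (|b p|)) :=
    isCompact_univ_pi fun p => isCompact_Icc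
  have hX : ∀ n, X n ∈ Set.univ.pi fun p : ℚ => Set.Icc (-|b p|) (|b p|) := by
    intro n p _
    rw [Set.mem_Icc, ← abs_le]
    by_cases hp : (0 : ℝ) < p
    · simp only [X, hp, if_true]
      have h1 := hsq (by positivity) ((hf n).decay p hp)
      refine le_trans ?_ (le_abs_self _)
      simp only [b]
      nlinarith [sq_nonneg (|f n p| - 1), sq_abs (f n p), abs_nonneg (f n p)]
    · simp only [X, hp, if_false, abs_zero]
      exact abs_nonneg _
  obtain ⟨Y, -, k, hk, hlim⟩ := hcpt.tendsto_subseq hX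
  rw [tendsto_pi_nhds] at hlim
  refine ⟨k, hk, ?_⟩
  suffices h : ∀ a : ℝ, 0 < a → ∃ y, Tendsto (fun n => f (k n) a) atTop (𝓝 y) by
    choose! g hg using h
    exact ⟨g, hg⟩
  intro a ha
  refine cauchySeq_tendsto_of_complete ?_
  rw [Metric.cauchySeq_iff]
  intro ε hε
  set D := C * (a ^ (N - 1))⁻¹ with hD
  have hD0 : 0 ≤ D := by positivity
  -- The rational is so close to `a` that `D * (p - a) < (ε / 3)²`; adding 1 to `D` avoids dividing
  -- by zero.
  obtain ⟨p, hap, hpa⟩ := exists_rat_btwn (show a < a + (ε / 3) ^ 2 / (D + 1) by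
    have : 0 < (ε / 3) ^ 2 / (D + 1) := by positivity
    linarith)
  have hclose : ∀ n, |f n p - f n a| < ε / 3 := by
    intro n
    refine abs_lt_of_sq_lt_sq ?_ (by positivity)
    have hpa0 : 0 < (p : ℝ) - a := by linarith
    have h1 := hsq (by positivity) ((hf n).holder a p ha hap)
    have h2 : ((p : ℝ) - a) * (D + 1) < (ε / 3) ^ 2 := by
      rw [← lt_div_iff₀ (by positivity)]; linarith
    have e : C * ((a ^ (N - 1))⁻¹ * (p - a)) = D * (p - a) := by rw [hD]; ring
    rw [e] at h1
    nlinarith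
  have hc : CauchySeq fun n => f (k n) p := by
    have h1 := (hlim p).cauchySeq
    have hp0 : (0 : ℝ) < p := ha.trans hap
    simpa only [X, Function.comp_apply, hp0, if_true] using h1
  obtain ⟨n₀, hn₀⟩ := Metric.cauchySeq_iff.1 hc (ε / 3) (by positivity)
  refine ⟨n₀, fun m hm n hn => ?_⟩
  have h1 := hn₀ m hm n hn
  have h2 := hclose (k m)
  have h3 := hclose (k n)
  rw [Real.dist_eq] at h1 ⊢
  rw [abs_lt] at *
  constructor <;> linarith [h1.1, h1.2, h2.1, h2.2, h3.1, h3.2]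

theorem exists_ae_tendsto_subseq (hN : 3 ≤ N) (hV : AEMeasurable fun x : Space N => V ‖x‖)
    {u : ℕ → Space N → ℝ} (hu : ∀ n, MemHVr V (u n)) {M : ℝ≥0} (hM : ∀ n, normHV V (u n) ≤ M) :
    ∃ k : ℕ → ℕ, StrictMono k ∧ ∃ w : Space N → ℝ, ∀ᵐ x,
      Tendsto (fun n => u (k n) x) atTop (𝓝 (w x)) := by
  choose f hf hb using fun n => (hu n).exists_radial_repr hN hV
  have hb' : ∀ n, RadialBound N (f n) (2 * (M : ℝ≥0∞) ^ 2) := by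
    intro n
    refine (hb n).mono ?_
    rw [← normHV_sq]
    gcongr
    exact hM n
  obtain ⟨k, hk, g, hg⟩ := tendsto_subseq_of_radialBound (by omega) (by finiteness) hb'
  refine ⟨k, hk, fun x => g ‖x‖, ?_⟩
  have hne : ∀ᵐ x : Space N, x ≠ 0 := by
    have : Nontrivial (Space N) := by
      have : Nonempty (Fin N) := ⟨⟨0, by omega⟩⟩
      infer_instance
    simp [ae_iff]
  filter_upwards [ae_all_iff.2 hf, hne] with x hx hx0
  simp_rw [hx]
  exact hg _ (norm_pos_iff.2 hx0)

/-! ### Suprema of weighted integrals over a set -/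

/-- `sup { ∫_A K(|x|) |u|^q dx : u ∈ H^1_{V,r}, ‖u‖ = 1 }`. -/
def supOn (N : ℕ) (V : ℝ → ℝ≥0∞) (K : ℝ → ℝ) (q : ℝ) (A : Set (Space N)) : ℝ≥0∞ :=
  ⨆ (u : Space N → ℝ) (_ : MemHVr V u) (_ : normHV V u = 1),
    ∫⁻ x in A, ENNReal.ofReal (K ‖x‖) * ‖u x‖ₑ ^ q

theorem Szero_eq (R : ℝ) : Szero N V K q R = supOn N V K q (Metric.ball 0 R) := rfl

theorem Sinfty_eq (R : ℝ) : Sinfty N V K q R = supOn N V K q (Metric.ball 0 R)ᶜ := rfl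

theorem supOn_le {A : Set (Space N)} {c : ℝ≥0∞}
    (h : ∀ u, MemHVr V u → normHV V u = 1 →
      ∫⁻ x in A, ENNReal.ofReal (K ‖x‖) * ‖u x‖ₑ ^ q ≤ c) : supOn N V K q A ≤ c :=
  iSup_le fun u => iSup_le fun hu => iSup_le fun h1 => h u hu h1

theorem le_supOn {A : Set (Space N)} {u : Space N → ℝ} (hu : MemHVr V u) (h1 : normHV V u = 1) :
    ∫⁻ x in A, ENNReal.ofReal (K ‖x‖) * ‖u x‖ₑ ^ q ≤ supOn N V K q A :=
  le_iSup_of_le u (le_iSup_of_le hu (le_iSup_of_le h1 le_rfl))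

theorem supOn_mono {A B : Set (Space N)} (h : A ⊆ B) : supOn N V K q A ≤ supOn N V K q B :=
  supOn_le fun _ hu h1 => (lintegral_mono_set h).trans (le_supOn hu h1)

theorem supOn_union_le (A B : Set (Space N)) :
    supOn N V K q (A ∪ B) ≤ supOn N V K q A + supOn N V K q B :=
  supOn_le fun _ hu h1 => (lintegral_union_le _ _ _).trans
    (add_le_add (le_supOn hu h1) (le_supOn hu h1))

theorem setLIntegral_weightMeasure_rpow (hN : N ≠ 0) (hK : IsPotentialK N K)
    {A : Set (Space N)} (hA : MeasurableSet A) {u : Space N → ℝ}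
    (hu : AEStronglyMeasurable u volume) :
    ∫⁻ x in A, ‖u x‖ₑ ^ q ∂weightMeasure N K =
      ∫⁻ x in A, ENNReal.ofReal (K ‖x‖) * ‖u x‖ₑ ^ q :=
  setLIntegral_weightMeasure hN hK hA (hu.enorm.pow_const q)

theorem lintegral_const_mul_rpow (hq : 0 ≤ q) (μ : Measure (Space N)) (u : Space N → ℝ) (c : ℝ) :
    ∫⁻ x, ‖c * u x‖ₑ ^ q ∂μ = ‖c‖ₑ ^ q * ∫⁻ x, ‖u x‖ₑ ^ q ∂μ := by
  rw [← lintegral_const_mul' _ _ (by finiteness)]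
  refine lintegral_congr fun x => ?_
  rw [enorm_mul, ENNReal.mul_rpow_of_nonneg _ _ hq]

/-- Homogeneity of degree `q`, after dividing `u` by its norm. -/
theorem MemHVr.lintegral_le_supOn (hN : 3 ≤ N) (hV : AEMeasurable fun x : Space N => V ‖x‖)
    (hK : IsPotentialK N K) (hq : 0 < q) {A : Set (Space N)} (hA : MeasurableSet A)
    {u : Space N → ℝ} (hu : MemHVr V u) :
    ∫⁻ x in A, ‖u x‖ₑ ^ q ∂weightMeasure N K ≤ supOn N V K q A * normHV V u ^ q := by
  by_cases h0 : normHV V u = 0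
  · have hz : ∫⁻ x in A, ‖u x‖ₑ ^ q ∂weightMeasure N K = 0 := by
      rw [lintegral_eq_zero_iff' ?_]
      · refine ae_restrict_of_ae ((weightMeasure_ac K).ae_le ?_)
        filter_upwards [hu.ae_eq_zero hN hV h0] with x hx
        simp [hx, hq]
      · exact ((hu.aestronglyMeasurable.enorm.pow_const q).mono_ac (weightMeasure_ac K)).restrict
    rw [hz]
    exact zero_le
  · have hT := hu.memHV.normHV_ne_top
    set c : ℝ := (normHV V u).toReal⁻¹ with hc
    have hce : ‖c‖ₑ = (normHV V u)⁻¹ := by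
      have hp : 0 < (normHV V u).toReal := ENNReal.toReal_pos h0 hT
      rw [hc, Real.enorm_of_nonneg (by positivity), ENNReal.ofReal_inv_of_pos hp,
        ENNReal.ofReal_toReal hT]
    have h1 : normHV V (fun x => c * u x) = 1 := by
      rw [normHV_const_mul hu.memHV.memD12, hce, ENNReal.inv_mul_cancel h0 hT]
    have h2 := le_supOn (K := K) (q := q) (A := A) (hu.const_mul c) h1
    rw [← setLIntegral_weightMeasure_rpow (by omega) hK hA (hu.const_mul c).aestronglyMeasurable,
      lintegral_const_mul_rpow hq.le, hce] at h2
    calc ∫⁻ x in A, ‖u x‖ₑ ^ q ∂weightMeasure N K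
        = ((normHV V u)⁻¹ ^ q * ∫⁻ x in A, ‖u x‖ₑ ^ q ∂weightMeasure N K) * normHV V u ^ q := by
          rw [mul_right_comm, ← ENNReal.mul_rpow_of_nonneg _ _ hq.le,
            ENNReal.inv_mul_cancel h0 hT, ENNReal.one_rpow, one_mul]
      _ ≤ _ := by gcongr

/-- Norm-one functions are uniformly bounded on the annulus, whose weighted measure is finite. Hence
finiteness of the suprema does not depend on the positive radius chosen. -/
theorem supOn_annulus_lt_top (hN : 3 ≤ N) (hV : AEMeasurable fun x : Space N => V ‖x‖)
    (hK : IsPotentialK N K) (hq : 0 < q) {a b : ℝ} (ha : 0 < a) (hab : a < b) :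
    supOn N V K q (Metric.ball 0 b \ Metric.ball 0 a) < ⊤ := by
  have hm : MeasurableSet (Metric.ball (0 : Space N) b \ Metric.ball 0 a) :=
    measurableSet_ball.diff measurableSet_ball
  refine lt_of_le_of_lt (b := decayConst N a ^ q *
    weightMeasure N K (Metric.ball 0 b \ Metric.ball 0 a)) (supOn_le fun u hu h1 => ?_) ?_
  · rw [← setLIntegral_weightMeasure_rpow (by omega) hK hm hu.aestronglyMeasurable,
      ← setLIntegral_const]
    refine lintegral_mono_ae ?_
    filter_upwards [ae_restrict_mem hm,
      ae_restrict_of_ae ((weightMeasure_ac K).ae_le (hu.ae_enorm_le hN hV ha))] with x hx hxu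
    rw [h1, mul_one] at hxu
    gcongr
    refine hxu ?_
    simpa using hx.2
  · exact ENNReal.mul_lt_top (ENNReal.rpow_lt_top_of_nonneg hq.le
      (decayConst_ne_top (by omega) a)) (weightMeasure_annulus_lt_top hN hK ha hab)

end

section

variable {N : ℕ} {V : ℝ → ℝ≥0∞} {K : ℝ → ℝ} {q q₁ q₂ : ℝ}

/-! ### The sum space -/

theorem eLpNorm_ofReal_eq {α : Type*} [MeasurableSpace α] {μ : Measure α} (hq : 0 < q)
    (u : α → ℝ) : eLpNorm u (ENNReal.ofReal q) μ = (∫⁻ x, ‖u x‖ₑ ^ q ∂μ) ^ (1 / q) := by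
  rw [eLpNorm_eq_lintegral_rpow_enorm_toReal (by simpa using hq) (by simp),
    ENNReal.toReal_ofReal hq.le]

theorem normSum_le {u u₁ u₂ : Space N → ℝ} (h : IsDecomp K q₁ q₂ u u₁ u₂) :
    normSum K q₁ q₂ u ≤ max (eLpNorm u₁ (ENNReal.ofReal q₁) (weightMeasure N K))
      (eLpNorm u₂ (ENNReal.ofReal q₂) (weightMeasure N K)) :=
  iInf_le_of_le u₁ (iInf_le_of_le u₂ (iInf_le_of_le h le_rfl))

theorem exists_isDecomp_of_normSum_lt {u : Space N → ℝ} {δ : ℝ≥0∞}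
    (h : normSum K q₁ q₂ u < δ) : ∃ u₁ u₂, IsDecomp K q₁ q₂ u u₁ u₂ ∧
      eLpNorm u₁ (ENNReal.ofReal q₁) (weightMeasure N K) < δ ∧
      eLpNorm u₂ (ENNReal.ofReal q₂) (weightMeasure N K) < δ := by
  simp only [normSum, iInf_lt_iff] at h
  obtain ⟨u₁, u₂, hd, hlt⟩ := h
  exact ⟨u₁, u₂, hd, max_lt_iff.1 hlt⟩

theorem IsDecomp.sub {u u₁ u₂ v v₁ v₂ : Space N → ℝ} (hu : IsDecomp K q₁ q₂ u u₁ u₂)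
    (hv : IsDecomp K q₁ q₂ v v₁ v₂) :
    IsDecomp K q₁ q₂ (fun x => u x - v x) (u₁ - v₁) (u₂ - v₂) where
  left := hu.left.sub hv.left
  right := hu.right.sub hv.right
  add_eq := by
    filter_upwards [hu.add_eq, hv.add_eq] with x hx hy
    rw [hx, hy]
    simp only [Pi.sub_apply]
    ring

theorem MemSum.sub {u v : Space N → ℝ} (hu : MemSum K q₁ q₂ u) (hv : MemSum K q₁ q₂ v) :
    MemSum K q₁ q₂ fun x => u x - v x := by
  obtain ⟨u₁, u₂, hu⟩ := hu
  obtain ⟨v₁, v₂, hv⟩ := hv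
  exact ⟨_, _, hu.sub hv⟩

theorem normSum_sub_lt (hq₁ : 1 ≤ q₁) (hq₂ : 1 ≤ q₂) {u v w : Space N → ℝ} {δ : ℝ≥0∞}
    (hu : normSum K q₁ q₂ (fun x => u x - w x) < δ)
    (hv : normSum K q₁ q₂ (fun x => v x - w x) < δ) :
    normSum K q₁ q₂ (fun x => u x - v x) < δ + δ := by
  obtain ⟨u₁, u₂, hud, hu1, hu2⟩ := exists_isDecomp_of_normSum_lt hu
  obtain ⟨v₁, v₂, hvd, hv1, hv2⟩ := exists_isDecomp_of_normSum_lt hv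
  have hd := hud.sub hvd
  have e : (fun x => (u x - w x) - (v x - w x)) = fun x => u x - v x := by ext x; ring
  rw [e] at hd
  refine (normSum_le hd).trans_lt (max_lt ?_ ?_)
  · exact (eLpNorm_sub_le hud.left.1 hvd.left.1 (by simpa using ENNReal.ofReal_le_ofReal hq₁)).trans_lt
      (ENNReal.add_lt_add hu1 hv1)
  · exact (eLpNorm_sub_le hud.right.1 hvd.right.1
      (by simpa using ENNReal.ofReal_le_ofReal hq₂)).trans_lt (ENNReal.add_lt_add hu2 hv2)

theorem memSum_of_lintegral_lt_top (hq₁ : 0 < q₁) (hq₂ : 0 < q₂) {A : Set (Space N)}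
    (hA : MeasurableSet A) {u : Space N → ℝ} (hu : AEStronglyMeasurable u volume)
    (h₁ : ∫⁻ x in A, ‖u x‖ₑ ^ q₁ ∂weightMeasure N K < ⊤)
    (h₂ : ∫⁻ x in Aᶜ, ‖u x‖ₑ ^ q₂ ∂weightMeasure N K < ⊤) :
    MemSum K q₁ q₂ u ∧ normSum K q₁ q₂ u ≤
      max ((∫⁻ x in A, ‖u x‖ₑ ^ q₁ ∂weightMeasure N K) ^ (1 / q₁))
        ((∫⁻ x in Aᶜ, ‖u x‖ₑ ^ q₂ ∂weightMeasure N K) ^ (1 / q₂)) := by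
  have e₁ : eLpNorm (A.indicator u) (ENNReal.ofReal q₁) (weightMeasure N K) =
      (∫⁻ x in A, ‖u x‖ₑ ^ q₁ ∂weightMeasure N K) ^ (1 / q₁) := by
    rw [eLpNorm_indicator_eq_eLpNorm_restrict hA, eLpNorm_ofReal_eq hq₁]
  have e₂ : eLpNorm (Aᶜ.indicator u) (ENNReal.ofReal q₂) (weightMeasure N K) =
      (∫⁻ x in Aᶜ, ‖u x‖ₑ ^ q₂ ∂weightMeasure N K) ^ (1 / q₂) := by
    rw [eLpNorm_indicator_eq_eLpNorm_restrict hA.compl, eLpNorm_ofReal_eq hq₂]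
  have hm := hu.mono_ac (weightMeasure_ac K)
  have hd : IsDecomp K q₁ q₂ u (A.indicator u) (Aᶜ.indicator u) := by
    refine ⟨⟨hm.indicator hA, ?_⟩, ⟨hm.indicator hA.compl, ?_⟩, Eventually.of_forall fun x => ?_⟩
    · rw [e₁]; exact ENNReal.rpow_lt_top_of_nonneg (by positivity) h₁.ne
    · rw [e₂]; exact ENNReal.rpow_lt_top_of_nonneg (by positivity) h₂.ne
    · exact (congrFun (Set.indicator_self_add_compl A u) x).symm
  refine ⟨⟨_, _, hd⟩, ?_⟩
  rw [← e₁, ← e₂]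
  exact normSum_le hd

/-! ### Sufficiency of the conditions -/

theorem supOn_compl_ball_lt_top (hN : 3 ≤ N) (hV : AEMeasurable fun x : Space N => V ‖x‖)
    (hK : IsPotentialK N K) (hq : 0 < q) {a R : ℝ} (ha : 0 < a)
    (h : supOn N V K q (Metric.ball 0 R)ᶜ < ⊤) : supOn N V K q (Metric.ball 0 a)ᶜ < ⊤ := by
  have hsub : (Metric.ball (0 : Space N) a)ᶜ ⊆
      (Metric.ball 0 R)ᶜ ∪ (Metric.ball 0 (max R (a + 1)) \ Metric.ball 0 a) := by
    intro x hx
    by_cases hR : x ∈ Metric.ball (0 : Space N) R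
    · exact Or.inr ⟨Metric.ball_subset_ball (le_max_left _ _) hR, hx⟩
    · exact Or.inl hR
  refine (supOn_mono hsub).trans_lt ((supOn_union_le _ _).trans_lt (ENNReal.add_lt_top.2 ⟨h, ?_⟩))
  exact supOn_annulus_lt_top hN hV hK hq ha (lt_max_of_lt_right (by linarith))

theorem continuouslyEmbedded_of_condFinite (hN : 3 ≤ N)
    (hV : AEMeasurable fun x : Space N => V ‖x‖) (hK : IsPotentialK N K)
    (hq₁ : 0 < q₁) (hq₂ : 0 < q₂) (h : CondFinite N V K q₁ q₂) :
    ContinuouslyEmbedded N V K q₁ q₂ := by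
  obtain ⟨R₁, R₂, hR₁, hR₂, h₁, h₂⟩ := h
  rw [Szero_eq] at h₁
  rw [Sinfty_eq] at h₂
  -- Both conditions are brought to the radius `R₁`, so that a ball and its complement partition the
  -- space.
  have h₃ := supOn_compl_ball_lt_top hN hV hK hq₂ hR₁ h₂
  set S₁ := supOn N V K q₁ (Metric.ball 0 R₁)
  set S₂ := supOn N V K q₂ (Metric.ball 0 R₁)ᶜ
  have hC : max (S₁ ^ (1 / q₁)) (S₂ ^ (1 / q₂)) ≠ ⊤ :=
    (max_lt (ENNReal.rpow_lt_top_of_nonneg (by positivity) h₁.ne)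
      (ENNReal.rpow_lt_top_of_nonneg (by positivity) h₃.ne)).ne
  refine ⟨(max (S₁ ^ (1 / q₁)) (S₂ ^ (1 / q₂))).toNNReal, fun u hu => ?_⟩
  have hfin := hu.memHV.normHV_ne_top
  have b₁ := hu.lintegral_le_supOn hN hV hK hq₁ (measurableSet_ball (x := 0) (ε := R₁))
  have b₂ := hu.lintegral_le_supOn hN hV hK hq₂ (measurableSet_ball (x := 0) (ε := R₁)).compl
  have key : ∀ {q : ℝ} {J S : ℝ≥0∞}, 0 < q → J ≤ S * normHV V u ^ q →
      J ^ (1 / q) ≤ S ^ (1 / q) * normHV V u := by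
    intro q J S hq hJ
    calc J ^ (1 / q) ≤ (S * normHV V u ^ q) ^ (1 / q) := by gcongr
      _ = _ := by
        rw [ENNReal.mul_rpow_of_nonneg _ _ (by positivity), ← ENNReal.rpow_mul,
          mul_one_div_cancel hq.ne', ENNReal.rpow_one]
  obtain ⟨hm, hn⟩ := memSum_of_lintegral_lt_top hq₁ hq₂ (measurableSet_ball (x := 0) (ε := R₁))
    hu.aestronglyMeasurable
    (b₁.trans_lt (ENNReal.mul_lt_top h₁ (ENNReal.rpow_lt_top_of_nonneg hq₁.le hfin)))
    (b₂.trans_lt (ENNReal.mul_lt_top h₃ (ENNReal.rpow_lt_top_of_nonneg hq₂.le hfin)))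
  refine ⟨hm, hn.trans ?_⟩
  rw [ENNReal.coe_toNNReal hC]
  refine max_le ((key hq₁ b₁).trans ?_) ((key hq₂ b₂).trans ?_)
  · gcongr; exact le_max_left _ _
  · gcongr; exact le_max_right _ _

/-- Along a bounded, almost everywhere convergent sequence of `H^1_{V,r}`, the weighted integrals
over `A` of the differences to the limit tend to zero, provided that the suprema on suitable
complements in `A` of annuli are small. -/
theorem tendsto_lintegral_sub_of_supOn_small (hN : 3 ≤ N)
    (hV : AEMeasurable fun x : Space N => V ‖x‖) (hK : IsPotentialK N K) (hq : 0 < q)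
    {u : ℕ → Space N → ℝ} (hu : ∀ n, MemHVr V (u n)) {M : ℝ≥0} (hM : ∀ n, normHV V (u n) ≤ M)
    {w : Space N → ℝ} (hw : ∀ᵐ x, Tendsto (fun n => u n x) atTop (𝓝 (w x)))
    {A : Set (Space N)} (hA : ∀ ε : ℝ≥0∞, 0 < ε → ∃ (B : Set (Space N)) (a b : ℝ),
      MeasurableSet B ∧ 0 < a ∧ a < b ∧ A ⊆ B ∪ (Metric.ball 0 b \ Metric.ball 0 a) ∧
      supOn N V K q B * (2 * M) ^ q ≤ ε) :
    Tendsto (fun n => ∫⁻ x in A, ‖u n x - w x‖ₑ ^ q ∂weightMeasure N K) atTop (𝓝 0) := by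
  have hwm : AEStronglyMeasurable w volume :=
    aestronglyMeasurable_of_tendsto_ae atTop (fun n => (hu n).aestronglyMeasurable) hw
  have hac := weightMeasure_ac (N := N) K
  have hlim : ∀ n, ∀ᵐ x, Tendsto (fun m => ‖u n x - u m x‖ₑ) atTop (𝓝 ‖u n x - w x‖ₑ) := by
    intro n
    filter_upwards [hw] with x hx
    exact (continuous_enorm.tendsto _).comp (tendsto_const_nhds.sub hx)
  have hdiff : ∀ n m, normHV V (fun x => u n x - u m x) ≤ 2 * M := fun n m =>
    normHV_sub_le hV (hu n).memHV.memD12 (hu m).memHV.memD12 (hM n) (hM m)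
  -- The limit `w` is not known to lie in `H^1_{V,r}`, so the bound is proved for `u n - u m`, of
  -- norm at most `2M`, and passed to `m → ∞`.
  have fatou : ∀ n (B : Set (Space N)), MeasurableSet B →
      ∫⁻ x in B, ‖u n x - w x‖ₑ ^ q ∂weightMeasure N K ≤ supOn N V K q B * (2 * M) ^ q := by
    intro n B hB
    calc ∫⁻ x in B, ‖u n x - w x‖ₑ ^ q ∂weightMeasure N K
        = ∫⁻ x in B, liminf (fun m => ‖u n x - u m x‖ₑ ^ q) atTop ∂weightMeasure N K := by
          refine lintegral_congr_ae (ae_restrict_of_ae (hac.ae_le ?_))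
          filter_upwards [hlim n] with x hx
          exact (hx.ennrpow_const q).liminf_eq.symm
      _ ≤ liminf (fun m => ∫⁻ x in B, ‖u n x - u m x‖ₑ ^ q ∂weightMeasure N K) atTop := by
          refine lintegral_liminf_le' fun m => ?_
          exact ((((hu n).sub hV (hu m)).aestronglyMeasurable.enorm.pow_const q).mono_ac
            hac).restrict
      _ ≤ _ := by
          refine liminf_le_of_le (by isBoundedDefault) fun c hc => ?_
          obtain ⟨m, hm⟩ := hc.exists
          refine hm.trans ((((hu n).sub hV (hu m)).lintegral_le_supOn hN hV hK hq hB).trans ?_)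
          gcongr
          exact hdiff n m
  -- Dominated convergence with a constant majorant, integrable since the annulus has finite
  -- weighted measure.
  have annulus : ∀ a b : ℝ, 0 < a → a < b → Tendsto (fun n =>
      ∫⁻ x in Metric.ball 0 b \ Metric.ball 0 a, ‖u n x - w x‖ₑ ^ q ∂weightMeasure N K)
      atTop (𝓝 0) := by
    intro a b ha hab
    have hm : MeasurableSet (Metric.ball (0 : Space N) b \ Metric.ball 0 a) :=
      measurableSet_ball.diff measurableSet_ball
    have hbd : ∀ n, ∀ᵐ x, a ≤ ‖x‖ → ‖u n x - w x‖ₑ ≤ decayConst N a * (2 * M) := by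
      intro n
      have hall : ∀ᵐ x, ∀ m, a ≤ ‖x‖ → ‖u n x - u m x‖ₑ ≤ decayConst N a *
          normHV V (fun x => u n x - u m x) :=
        ae_all_iff.2 fun m => ((hu n).sub hV (hu m)).ae_enorm_le hN hV ha
      filter_upwards [hlim n, hall] with x hx hxm hax
      refine le_of_tendsto' hx fun m => (hxm m hax).trans ?_
      gcongr
      exact hdiff n m
    have := tendsto_lintegral_of_dominated_convergence'
      (μ := (weightMeasure N K).restrict (Metric.ball 0 b \ Metric.ball 0 a))
      (F := fun n x => ‖u n x - w x‖ₑ ^ q) (f := fun _ => 0)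
      (fun _ => (decayConst N a * (2 * M)) ^ q) (fun n => ?_) (fun n => ?_) ?_ ?_
    · simpa using this
    · exact ((((hu n).aestronglyMeasurable.sub hwm).enorm.pow_const q).mono_ac hac).restrict
    · filter_upwards [ae_restrict_mem hm, ae_restrict_of_ae (hac.ae_le (hbd n))] with x hx hxb
      gcongr
      exact hxb (by simpa using hx.2)
    · rw [setLIntegral_const]
      refine ENNReal.mul_ne_top ?_ (weightMeasure_annulus_lt_top hN hK ha hab).ne
      have := decayConst_ne_top (N := N) (by omega) a
      exact ENNReal.rpow_ne_top_of_nonneg hq.le (by finiteness)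
    · refine ae_restrict_of_ae (hac.ae_le ?_)
      filter_upwards [hw] with x hx
      have h1 : Tendsto (fun n => ‖u n x - w x‖ₑ) atTop (𝓝 0) := by
        have := (continuous_enorm.tendsto _).comp (hx.sub_const (w x))
        simpa [Function.comp_def] using this
      simpa [hq] using h1.ennrpow_const q
  rw [ENNReal.tendsto_nhds_zero]
  intro ε hε
  have hε2 : 0 < ε / 2 := ENNReal.div_pos hε.ne' (by simp)
  obtain ⟨B, a, b, hB, ha, hab, hsub, hS⟩ := hA (ε / 2) hε2
  filter_upwards [ENNReal.tendsto_nhds_zero.1 (annulus a b ha hab) (ε / 2) hε2] with n hn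
  calc ∫⁻ x in A, ‖u n x - w x‖ₑ ^ q ∂weightMeasure N K ≤ _ := lintegral_mono_set hsub
    _ ≤ _ := lintegral_union_le _ _ _
    _ ≤ ε / 2 + ε / 2 := add_le_add ((fatou n B hB).trans hS) hn
    _ = ε := ENNReal.add_halves ε

theorem CondVanishing.condFinite (h : CondVanishing N V K q₁ q₂) : CondFinite N V K q₁ q₂ := by
  obtain ⟨R₁, h₁, hR₁⟩ := ((h.1.eventually_lt_const ENNReal.zero_lt_top).and
    self_mem_nhdsWithin).exists
  obtain ⟨R₂, h₂, hR₂⟩ := ((h.2.eventually_lt_const ENNReal.zero_lt_top).and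
    (eventually_gt_atTop 0)).exists
  exact ⟨R₁, R₂, hR₁, hR₂, h₁, h₂⟩

theorem compactlyEmbedded_of_condVanishing (hN : 3 ≤ N)
    (hV : AEMeasurable fun x : Space N => V ‖x‖) (hK : IsPotentialK N K)
    (hq₁ : 0 < q₁) (hq₂ : 0 < q₂) (h : CondVanishing N V K q₁ q₂) :
    CompactlyEmbedded N V K q₁ q₂ := by
  have hce := continuouslyEmbedded_of_condFinite hN hV hK hq₁ hq₂ h.condFinite
  refine ⟨hce, fun u hu ⟨M, hM⟩ => ?_⟩
  obtain ⟨k, hk, w, hw⟩ := exists_ae_tendsto_subseq hN hV hu hM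
  have hwm : AEStronglyMeasurable w volume :=
    aestronglyMeasurable_of_tendsto_ae atTop (fun n => (hu (k n)).aestronglyMeasurable) hw
  have hMq : ∀ {q : ℝ}, 0 < q → (2 * (M : ℝ≥0∞)) ^ q ≠ ⊤ := fun hq =>
    ENNReal.rpow_ne_top_of_nonneg hq.le (by finiteness)
  have hin : Tendsto (fun n => ∫⁻ x in Metric.ball 0 1,
      ‖u (k n) x - w x‖ₑ ^ q₁ ∂weightMeasure N K) atTop (𝓝 0) := by
    refine tendsto_lintegral_sub_of_supOn_small hN hV hK hq₁ (fun n => hu (k n))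
      (fun n => hM (k n)) hw fun ε hε => ?_
    have ht := ENNReal.Tendsto.mul_const h.1 (Or.inr (hMq hq₁))
    rw [zero_mul] at ht
    obtain ⟨R, ⟨hRε, hR0⟩, hR1⟩ := (((ENNReal.tendsto_nhds_zero.1 ht ε hε).and
      self_mem_nhdsWithin).and (Ioo_mem_nhdsGT one_pos)).exists
    refine ⟨Metric.ball 0 R, R, 1, measurableSet_ball, hR0, hR1.2, fun x hx => ?_, hRε⟩
    by_cases hxR : x ∈ Metric.ball (0 : Space N) R
    · exact Or.inl hxR
    · exact Or.inr ⟨hx, hxR⟩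
  have hout : Tendsto (fun n => ∫⁻ x in (Metric.ball 0 1)ᶜ,
      ‖u (k n) x - w x‖ₑ ^ q₂ ∂weightMeasure N K) atTop (𝓝 0) := by
    refine tendsto_lintegral_sub_of_supOn_small hN hV hK hq₂ (fun n => hu (k n))
      (fun n => hM (k n)) hw fun ε hε => ?_
    have ht := ENNReal.Tendsto.mul_const h.2 (Or.inr (hMq hq₂))
    rw [zero_mul] at ht
    obtain ⟨R, hRε, hR1⟩ := ((ENNReal.tendsto_nhds_zero.1 ht ε hε).and
      (eventually_gt_atTop 1)).exists
    refine ⟨(Metric.ball 0 R)ᶜ, 1, R, measurableSet_ball.compl, one_pos, hR1,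
      fun x hx => ?_, hRε⟩
    by_cases hxR : x ∈ Metric.ball (0 : Space N) R
    · exact Or.inr ⟨hxR, hx⟩
    · exact Or.inl hxR
  have hev : ∀ᶠ n in atTop, MemSum K q₁ q₂ (fun x => u (k n) x - w x) ∧
      normSum K q₁ q₂ (fun x => u (k n) x - w x) ≤
      max ((∫⁻ x in Metric.ball 0 1, ‖u (k n) x - w x‖ₑ ^ q₁ ∂weightMeasure N K) ^ (1 / q₁))
        ((∫⁻ x in (Metric.ball 0 1)ᶜ, ‖u (k n) x - w x‖ₑ ^ q₂ ∂weightMeasure N K)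
          ^ (1 / q₂)) := by
    filter_upwards [hin.eventually_lt_const ENNReal.zero_lt_top,
      hout.eventually_lt_const ENNReal.zero_lt_top] with n h1 h2
    exact memSum_of_lintegral_lt_top hq₁ hq₂ measurableSet_ball
      ((hu (k n)).aestronglyMeasurable.sub hwm) h1 h2
  refine ⟨w, ?_, k, hk, ?_⟩
  -- Here `w = u - (u - w)` with both terms in the sum space, for some late term `u` of the
  -- subsequence.
  · obtain ⟨n, hn, -⟩ := hev.exists
    obtain ⟨C, hC⟩ := hce
    have := (hC _ (hu (k n))).1.sub hn
    simpa using this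
  · refine tendsto_of_tendsto_of_tendsto_of_le_of_le' tendsto_const_nhds ?_
      (Eventually.of_forall fun _ => zero_le) (hev.mono fun n hn => hn.2)
    have h1 := hin.ennrpow_const (1 / q₁)
    have h2 := hout.ennrpow_const (1 / q₂)
    rw [ENNReal.zero_rpow_of_pos (by positivity)] at h1 h2
    simpa using h1.max h2

end

section

variable {N : ℕ} {V : ℝ → ℝ≥0∞} {K : ℝ → ℝ} {q q₁ q₂ : ℝ}

/-! ### Necessity of the conditions -/

/-- On bounded subsets of `H^1_{V,r}`, smallness in `L^{q₁}_K + L^{q₂}_K` implies smallness in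
`L^q_K(A)`. -/
def SumControls (N : ℕ) (V : ℝ → ℝ≥0∞) (K : ℝ → ℝ) (q₁ q₂ q : ℝ) (A : Set (Space N)) : Prop :=
  ∀ ε : ℝ≥0∞, 0 < ε → ∃ δ : ℝ≥0∞, 0 < δ ∧ ∀ v : Space N → ℝ, MemHVr V v → normHV V v ≤ 2 →
    normSum K q₁ q₂ v < δ → ∫⁻ x in A, ‖v x‖ₑ ^ q ∂weightMeasure N K ≤ ε

/-- On a set of finite weighted measure Hölder embeds `L^{q₂}_K` in `L^{q₁}_K`, with constant `c =
μ(A)^{1/q₁ - 1/q₂}`. Both pieces of a decomposition are then measured in `L^{q₁}_K(A)`, with total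
at most `(1 + c)δ`. -/
theorem sumControls_of_measure_lt_top (hq₁ : 1 ≤ q₁) (h12 : q₁ ≤ q₂) {A : Set (Space N)}
    (hA : weightMeasure N K A < ⊤) : SumControls N V K q₁ q₂ q₁ A := by
  intro ε hε
  have hq0 : 0 < q₁ := by linarith
  set c := weightMeasure N K A ^ (1 / q₁ - 1 / q₂) with hc
  have hc1 : 1 + c ≠ ⊤ := by
    refine ENNReal.add_ne_top.2 ⟨ENNReal.one_ne_top, ENNReal.rpow_ne_top_of_nonneg ?_ hA.ne⟩
    exact sub_nonneg.2 (one_div_le_one_div_of_le hq0 h12)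
  refine ⟨ε ^ (1 / q₁) / (1 + c), ENNReal.div_pos (ENNReal.rpow_pos_of_nonneg hε
    (by positivity)).ne' hc1, fun v _ _ hv => ?_⟩
  obtain ⟨a, b, hd, ha, hb⟩ := exists_isDecomp_of_normSum_lt hv
  set δ := ε ^ (1 / q₁) / (1 + c)
  set μ := (weightMeasure N K).restrict A
  have hp : (1 : ℝ≥0∞) ≤ ENNReal.ofReal q₁ := by simpa using ENNReal.ofReal_le_ofReal hq₁
  have hvab : eLpNorm v (ENNReal.ofReal q₁) μ = eLpNorm (a + b) (ENNReal.ofReal q₁) μ :=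
    eLpNorm_congr_ae (ae_restrict_of_ae ((weightMeasure_ac K).ae_le hd.add_eq))
  have hbμ : eLpNorm b (ENNReal.ofReal q₁) μ ≤ δ * c := by
    refine (eLpNorm_le_eLpNorm_mul_rpow_measure_univ (ENNReal.ofReal_le_ofReal h12)
      hd.right.1.restrict).trans ?_
    rw [ENNReal.toReal_ofReal hq0.le, ENNReal.toReal_ofReal (hq0.le.trans h12),
      Measure.restrict_apply_univ]
    gcongr
    exact (eLpNorm_restrict_le _ _ _ _).trans hb.le
  have htot : eLpNorm v (ENNReal.ofReal q₁) μ ≤ ε ^ (1 / q₁) := by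
    calc _ = _ := hvab
      _ ≤ _ := eLpNorm_add_le hd.left.1.restrict hd.right.1.restrict hp
      _ ≤ δ + δ * c := add_le_add ((eLpNorm_restrict_le _ _ _ _).trans ha.le) hbμ
      _ = (1 + c) * δ := by ring
      _ ≤ _ := ENNReal.mul_div_le
  rw [eLpNorm_ofReal_eq hq0] at htot
  exact (ENNReal.rpow_le_rpow_iff (by positivity)).1 htot

/-- The sum is at most twice the larger term. When that is `a`, the excess power `q₂ - q₁` is
absorbed by the bound `M`. -/
theorem enorm_add_rpow_le (h0 : 0 ≤ q₁) (h12 : q₁ ≤ q₂) {a b : ℝ} {M : ℝ≥0∞}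
    (hM : ‖a + b‖ₑ ≤ M) : ‖a + b‖ₑ ^ q₂ ≤
      M ^ (q₂ - q₁) * 2 ^ q₁ * ‖a‖ₑ ^ q₁ + 2 ^ q₂ * ‖b‖ₑ ^ q₂ := by
  have hab : ‖a + b‖ₑ ≤ ‖a‖ₑ + ‖b‖ₑ := enorm_add_le a b
  rcases le_total ‖a‖ₑ ‖b‖ₑ with h | h
  · refine le_trans ?_ le_add_self
    rw [← ENNReal.mul_rpow_of_nonneg _ _ (h0.trans h12)]
    gcongr
    · exact h0.trans h12
    · rw [two_mul]; exact hab.trans (by gcongr)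
  · refine le_trans ?_ le_self_add
    rw [mul_assoc, ← ENNReal.mul_rpow_of_nonneg _ _ h0]
    have e : ‖a + b‖ₑ ^ q₂ = ‖a + b‖ₑ ^ (q₂ - q₁) * ‖a + b‖ₑ ^ q₁ := by
      rw [← ENNReal.rpow_add_of_nonneg _ _ (sub_nonneg.2 h12) h0, sub_add_cancel]
    rw [e]
    gcongr
    rw [two_mul]; exact hab.trans (by gcongr)

/-- Off the ball, `v` is bounded by the decay estimate, so the `L^{q₁}_K` piece of a decomposition
also controls the power `q₂`. The factor 2 in `M` is the norm bound in `SumControls`. -/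
theorem sumControls_compl_ball (hN : 3 ≤ N) (hV : AEMeasurable fun x : Space N => V ‖x‖)
    (hq₁ : 0 < q₁) (h12 : q₁ ≤ q₂) {R : ℝ} (hR : 0 < R) :
    SumControls N V K q₁ q₂ q₂ (Metric.ball 0 R)ᶜ := by
  intro ε hε
  have hq₂ : 0 < q₂ := hq₁.trans_le h12
  set M := decayConst N R * 2 with hM
  have hMt : M ≠ ⊤ := by
    have := decayConst_ne_top (N := N) (by omega) R
    finiteness
  have hc₁ : M ^ (q₂ - q₁) * 2 ^ q₁ ≠ ⊤ := ENNReal.mul_ne_top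
    (ENNReal.rpow_ne_top_of_nonneg (sub_nonneg.2 h12) hMt)
    (ENNReal.rpow_ne_top_of_nonneg hq₁.le (by simp))
  have hc₂ : (2 : ℝ≥0∞) ^ q₂ ≠ ⊤ := ENNReal.rpow_ne_top_of_nonneg hq₂.le (by simp)
  have hlim : Tendsto (fun δ : ℝ≥0∞ => M ^ (q₂ - q₁) * 2 ^ q₁ * δ ^ q₁ + 2 ^ q₂ * δ ^ q₂)
      (𝓝 0) (𝓝 0) := by
    have h : ∀ {q : ℝ} {c : ℝ≥0∞}, 0 < q → c ≠ ⊤ →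
        Tendsto (fun δ : ℝ≥0∞ => c * δ ^ q) (𝓝 0) (𝓝 0) := by
      intro q c hq hc
      have h1 : Tendsto (fun δ : ℝ≥0∞ => δ ^ q) (𝓝 0) (𝓝 0) := by
        simpa [hq] using (ENNReal.continuous_rpow_const (y := q)).tendsto 0
      simpa using ENNReal.Tendsto.const_mul h1 (Or.inr hc)
    simpa using (h hq₁ hc₁).add (h hq₂ hc₂)
  obtain ⟨δ, hδε, hδ0⟩ := (((ENNReal.tendsto_nhds_zero.1 hlim ε hε).filter_mono
    nhdsWithin_le_nhds).and (self_mem_nhdsWithin (s := Set.Ioi (0 : ℝ≥0∞)))).exists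
  refine ⟨δ, hδ0, fun v hv hv2 hvs => ?_⟩
  obtain ⟨a, b, hd, ha, hb⟩ := exists_isDecomp_of_normSum_lt hvs
  refine le_trans ?_ hδε
  have hpow : ∀ {q : ℝ} {f : Space N → ℝ}, 0 < q →
      eLpNorm f (ENNReal.ofReal q) (weightMeasure N K) < δ →
      ∫⁻ x, ‖f x‖ₑ ^ q ∂weightMeasure N K ≤ δ ^ q := by
    intro q f hq hf
    rw [eLpNorm_ofReal_eq hq] at hf
    rw [← ENNReal.rpow_le_rpow_iff (z := 1 / q) (by positivity), ← ENNReal.rpow_mul,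
      mul_one_div_cancel hq.ne', ENNReal.rpow_one]
    exact hf.le
  have hRm : MeasurableSet (Metric.ball (0 : Space N) R)ᶜ := measurableSet_ball.compl
  calc ∫⁻ x in (Metric.ball 0 R)ᶜ, ‖v x‖ₑ ^ q₂ ∂weightMeasure N K
      ≤ ∫⁻ x in (Metric.ball 0 R)ᶜ, (M ^ (q₂ - q₁) * 2 ^ q₁ * ‖a x‖ₑ ^ q₁ +
          2 ^ q₂ * ‖b x‖ₑ ^ q₂) ∂weightMeasure N K := by
        refine lintegral_mono_ae ?_
        filter_upwards [ae_restrict_mem hRm,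
          ae_restrict_of_ae ((weightMeasure_ac K).ae_le hd.add_eq),
          ae_restrict_of_ae ((weightMeasure_ac K).ae_le (hv.ae_enorm_le hN hV hR))]
          with x hx hxe hxb
        rw [hxe] at hxb ⊢
        refine enorm_add_rpow_le hq₁.le h12 ((hxb (by simpa using hx)).trans ?_)
        rw [hM]
        gcongr
    _ ≤ ∫⁻ x, (M ^ (q₂ - q₁) * 2 ^ q₁ * ‖a x‖ₑ ^ q₁ +
          2 ^ q₂ * ‖b x‖ₑ ^ q₂) ∂weightMeasure N K := setLIntegral_le_lintegral _ _
    _ = M ^ (q₂ - q₁) * 2 ^ q₁ * (∫⁻ x, ‖a x‖ₑ ^ q₁ ∂weightMeasure N K) +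
          2 ^ q₂ * ∫⁻ x, ‖b x‖ₑ ^ q₂ ∂weightMeasure N K := by
        rw [lintegral_add_left' ((hd.left.1.enorm.pow_const q₁).const_mul _),
          lintegral_const_mul' _ _ hc₁, lintegral_const_mul' _ _ hc₂]
    _ ≤ _ := by
        gcongr
        · exact hpow hq₁ ha
        · exact hpow hq₂ hb

/-- Scaling a norm-one function by a small `t` makes its sum norm less than `δ`, so its integral is
at most 1; undoing the scaling bounds the supremum by `t^{-q}`. -/
theorem SumControls.supOn_lt_top (hN : N ≠ 0) (hK : IsPotentialK N K) (hq : 0 < q)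
    {A : Set (Space N)} (hA : MeasurableSet A) (h : SumControls N V K q₁ q₂ q A)
    (hc : ContinuouslyEmbedded N V K q₁ q₂) : supOn N V K q A < ⊤ := by
  obtain ⟨C, hC⟩ := hc
  obtain ⟨δ, hδ0, hδ⟩ := h 1 one_pos
  have hlim : Tendsto (fun t : ℝ≥0 => (C : ℝ≥0∞) * t) (𝓝 0) (𝓝 0) := by
    have h1 : Tendsto (fun t : ℝ≥0 => (t : ℝ≥0∞)) (𝓝 0) (𝓝 0) := by
      simpa using (ENNReal.continuous_coe.tendsto (0 : ℝ≥0))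
    simpa using ENNReal.Tendsto.const_mul h1 (Or.inr (ENNReal.coe_ne_top (r := C)))
  obtain ⟨t, ⟨htδ, ht2⟩, ht0⟩ := ((((hlim.eventually_lt_const hδ0).and
    (eventually_le_nhds (show (0 : ℝ≥0) < 2 by norm_num))).filter_mono nhdsWithin_le_nhds).and
    (self_mem_nhdsWithin (s := Set.Ioi (0 : ℝ≥0)))).exists
  have ht0' : (t : ℝ≥0∞) ≠ 0 := by simpa using (show t ≠ 0 from ne_of_gt ht0)
  have htq0 : (t : ℝ≥0∞) ^ q ≠ 0 := (ENNReal.rpow_pos_of_nonneg (pos_iff_ne_zero.2 ht0') hq.le).ne'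
  have htqt : (t : ℝ≥0∞) ^ q ≠ ⊤ := ENNReal.rpow_ne_top_of_nonneg hq.le ENNReal.coe_ne_top
  refine lt_of_le_of_lt (b := ((t : ℝ≥0∞) ^ q)⁻¹) (supOn_le fun u hu h1 => ?_)
    (ENNReal.inv_lt_top.2 (pos_iff_ne_zero.2 htq0))
  have hte : ‖(t : ℝ)‖ₑ = t := by simp
  have hn : normHV V (fun x => (t : ℝ) * u x) = t := by
    rw [normHV_const_mul hu.memHV.memD12, h1, mul_one, hte]
  have hv := hu.const_mul (t : ℝ)
  have hs := (hC _ hv).2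
  rw [hn] at hs
  have hJ := hδ _ hv (by rw [hn]; exact_mod_cast ht2) (hs.trans_lt htδ)
  rw [lintegral_const_mul_rpow hq.le, hte] at hJ
  rw [← setLIntegral_weightMeasure_rpow hN hK hA hu.aestronglyMeasurable]
  rw [ENNReal.le_inv_iff_mul_le, mul_comm]
  exact hJ

theorem enorm_rpow_le_sub_add (hq : 0 ≤ q) (a b : ℝ) :
    ‖a‖ₑ ^ q ≤ 2 ^ q * ‖a - b‖ₑ ^ q + 2 ^ q * ‖b‖ₑ ^ q := by
  have := enorm_add_rpow_le (q₁ := q) (q₂ := q) hq le_rfl (a := a - b) (b := b) (M := ⊤) le_top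
  simpa using this

/-- Otherwise there are norm-one `u n` with mass above `ε` on each `A n`. Along a subsequence
convergent in the sum space, late terms are close in `L^q_K(A 0)` to one fixed `u (k m)`, whose mass
on `A (k n)` tends to 0. Differences of norm-one functions have norm at most 2, whence the bound in
`SumControls`. -/
theorem SumControls.tendsto_supOn (hN : 3 ≤ N) (hV : AEMeasurable fun x : Space N => V ‖x‖)
    (hK : IsPotentialK N K) (hq₁ : 1 ≤ q₁) (hq₂ : 1 ≤ q₂) (hq : 0 < q)
    {A : ℕ → Set (Space N)} (hA : ∀ n, MeasurableSet (A n)) (hanti : Antitone A)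
    (hinter : volume (⋂ n, A n) = 0) (h : SumControls N V K q₁ q₂ q (A 0))
    (hc : CompactlyEmbedded N V K q₁ q₂) :
    Tendsto (fun n => supOn N V K q (A n)) atTop (𝓝 0) := by
  have hfin := h.supOn_lt_top (by omega) hK hq (hA 0) hc.1
  rw [ENNReal.tendsto_atTop_zero]
  by_contra hcon
  push Not at hcon
  obtain ⟨ε, hε, hcon⟩ := hcon
  have hlt : ∀ n, ε < supOn N V K q (A n) := by
    intro n
    obtain ⟨m, hm, hlt⟩ := hcon n
    exact hlt.trans_le (supOn_mono (hanti hm))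
  have hεt : ε ≠ ⊤ := ((hlt 0).trans hfin).ne
  have hex : ∀ n, ∃ u : Space N → ℝ, MemHVr V u ∧ normHV V u = 1 ∧
      ε < ∫⁻ x in A n, ‖u x‖ₑ ^ q ∂weightMeasure N K := by
    intro n
    have := hlt n
    simp only [supOn, lt_iSup_iff] at this
    obtain ⟨u, hu, h1, hlt⟩ := this
    refine ⟨u, hu, h1, ?_⟩
    rwa [setLIntegral_weightMeasure_rpow (by omega) hK (hA n) hu.aestronglyMeasurable]
  choose u hu hu1 huε using hex
  obtain ⟨w, -, k, hk, hlim⟩ := hc.2 u hu ⟨1, fun n => by simp [hu1 n]⟩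
  have h2q0 : (2 : ℝ≥0∞) ^ q ≠ 0 := (ENNReal.rpow_pos (by simp) (by simp)).ne'
  have h2qt : (2 : ℝ≥0∞) ^ q ≠ ⊤ := ENNReal.rpow_ne_top_of_nonneg hq.le (by simp)
  -- Chosen so that `2^q * η + 2^q * η ≤ ε`, with `2^q` the constant of `enorm_rpow_le_sub_add`.
  set η := ε / 2 ^ q / 2 with hη
  have hη0 : 0 < η := ENNReal.div_pos (ENNReal.div_pos hε.ne' h2qt).ne' (by simp)
  obtain ⟨δ, hδ0, hδ⟩ := h η hη0
  have hδ2 : 0 < δ / 2 := ENNReal.div_pos hδ0.ne' (by simp)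
  obtain ⟨m, hm⟩ := eventually_atTop.1 (hlim.eventually_lt_const hδ2)
  have hum := (hu (k m)).lintegral_le_supOn hN hV hK hq (hA 0)
  rw [hu1, ENNReal.one_rpow, mul_one] at hum
  -- the tails of the fixed function `u (k m)` vanish
  set ν := (weightMeasure N K).withDensity fun x => ‖u (k m) x‖ₑ ^ q with hν
  have hνA : ∀ n, ν (A n) = ∫⁻ x in A n, ‖u (k m) x‖ₑ ^ q ∂weightMeasure N K := fun n =>
    withDensity_apply _ (hA n)
  have htail : Tendsto (fun n => ν (A (k n))) atTop (𝓝 0) := by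
    have h1 := tendsto_measure_iInter_atTop (μ := ν) (fun n => (hA n).nullMeasurableSet) hanti
      ⟨0, by rw [hνA]; exact (hum.trans_lt hfin).ne⟩
    have h0 : ν (⋂ n, A n) = 0 :=
      ((withDensity_absolutelyContinuous _ _).trans (weightMeasure_ac K)) hinter
    rw [h0] at h1
    exact h1.comp hk.tendsto_atTop
  obtain ⟨n, hn, hmn⟩ := ((ENNReal.tendsto_nhds_zero.1 htail η hη0).and
    (eventually_ge_atTop m)).exists
  rw [hνA] at hn
  have hsum : normSum K q₁ q₂ (fun x => u (k n) x - u (k m) x) < δ := by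
    have := normSum_sub_lt hq₁ hq₂ (hm n hmn) (hm m le_rfl)
    rwa [ENNReal.add_halves] at this
  have hnorm : normHV V (fun x => u (k n) x - u (k m) x) ≤ 2 := by
    simpa using normHV_sub_le hV (hu (k n)).memHV.memD12 (hu (k m)).memHV.memD12
      (hu1 _).le (hu1 _).le
  have hJ := hδ _ ((hu (k n)).sub hV (hu (k m))) hnorm hsum
  refine absurd (huε (k n)) (not_lt.2 ?_)
  have hmeas : AEMeasurable (fun x => 2 ^ q * ‖u (k n) x - u (k m) x‖ₑ ^ q)
      ((weightMeasure N K).restrict (A (k n))) :=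
    (((((hu (k n)).sub hV (hu (k m))).aestronglyMeasurable.enorm.pow_const q).mono_ac
      (weightMeasure_ac K)).restrict).const_mul _
  calc ∫⁻ x in A (k n), ‖u (k n) x‖ₑ ^ q ∂weightMeasure N K
      ≤ ∫⁻ x in A (k n), (2 ^ q * ‖u (k n) x - u (k m) x‖ₑ ^ q + 2 ^ q * ‖u (k m) x‖ₑ ^ q)
          ∂weightMeasure N K := lintegral_mono fun x => enorm_rpow_le_sub_add hq.le _ _
    _ = 2 ^ q * (∫⁻ x in A (k n), ‖u (k n) x - u (k m) x‖ₑ ^ q ∂weightMeasure N K) +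
          2 ^ q * ∫⁻ x in A (k n), ‖u (k m) x‖ₑ ^ q ∂weightMeasure N K := by
        rw [lintegral_add_left' hmeas, lintegral_const_mul' _ _ h2qt,
          lintegral_const_mul' _ _ h2qt]
    _ ≤ 2 ^ q * η + 2 ^ q * η := by
        gcongr
        exact (lintegral_mono_set (hanti (Nat.zero_le _))).trans hJ
    _ = 2 ^ q * (ε / 2 ^ q) := by rw [← mul_add, hη, ENNReal.add_halves]
    _ ≤ ε := ENNReal.mul_div_le

theorem weightMeasure_ball_lt_top
    (hK : IntegrableOn (fun x : Space N => K ‖x‖) (Metric.ball (0 : Space N) 1) volume) :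
    weightMeasure N K (Metric.ball 0 1) < ⊤ := by
  rw [weightMeasure, withDensity_apply _ measurableSet_ball]
  exact lt_of_le_of_lt (lintegral_mono fun x => Real.ofReal_le_enorm _) hK.2

theorem condFinite_of_continuouslyEmbedded (hN : 3 ≤ N)
    (hV : AEMeasurable fun x : Space N => V ‖x‖) (hK : IsPotentialK N K)
    (hq₁ : 1 ≤ q₁) (h12 : q₁ ≤ q₂)
    (hK1 : IntegrableOn (fun x : Space N => K ‖x‖) (Metric.ball (0 : Space N) 1) volume)
    (h : ContinuouslyEmbedded N V K q₁ q₂) : CondFinite N V K q₁ q₂ := by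
  refine ⟨1, 1, one_pos, one_pos, ?_, ?_⟩
  · exact (sumControls_of_measure_lt_top hq₁ h12 (weightMeasure_ball_lt_top hK1)).supOn_lt_top
      (by omega) hK (by linarith) measurableSet_ball h
  · exact (sumControls_compl_ball hN hV (by linarith) h12 one_pos).supOn_lt_top
      (by omega) hK (by linarith) measurableSet_ball.compl h

theorem condVanishing_of_compactlyEmbedded (hN : 3 ≤ N)
    (hV : AEMeasurable fun x : Space N => V ‖x‖) (hK : IsPotentialK N K)
    (hq₁ : 1 ≤ q₁) (h12 : q₁ ≤ q₂)
    (hK1 : IntegrableOn (fun x : Space N => K ‖x‖) (Metric.ball (0 : Space N) 1) volume)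
    (h : CompactlyEmbedded N V K q₁ q₂) : CondVanishing N V K q₁ q₂ := by
  have : Nontrivial (Space N) := by
    have : Nonempty (Fin N) := ⟨⟨0, by omega⟩⟩
    infer_instance
  constructor
  -- The radii start at 1, so that the largest set is `B_1`, of finite weighted measure.
  -- Monotonicity in the radius then passes from the sequence to the limit `R → 0⁺`.
  · have hin : Tendsto (fun n : ℕ => supOn N V K q₁ (Metric.ball 0 (1 / ((n : ℝ) + 1))))
        atTop (𝓝 0) := by
      refine SumControls.tendsto_supOn hN hV hK hq₁ (hq₁.trans h12) (by linarith)
        (fun n => measurableSet_ball) (fun m n hmn => ?_) ?_ ?_ h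
      · refine Metric.ball_subset_ball ?_
        gcongr
      · refine measure_mono_null (t := {0}) (fun x hx => ?_) (measure_singleton 0)
        rw [Set.mem_iInter] at hx
        by_contra hx0
        obtain ⟨n, hn⟩ := exists_nat_one_div_lt (norm_pos_iff.2 hx0)
        exact absurd (mem_ball_zero_iff.1 (hx n)) (not_lt.2 hn.le)
      · simpa using sumControls_of_measure_lt_top hq₁ h12 (weightMeasure_ball_lt_top hK1)
    rw [ENNReal.tendsto_nhds_zero]
    intro ε hε
    obtain ⟨n, hn⟩ := (ENNReal.tendsto_nhds_zero.1 hin ε hε).exists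
    filter_upwards [Ioo_mem_nhdsGT (show (0 : ℝ) < 1 / ((n : ℝ) + 1) by positivity)] with R hR
    exact (supOn_mono (Metric.ball_subset_ball hR.2.le)).trans hn
  · have hout : Tendsto (fun n : ℕ => supOn N V K q₂ (Metric.ball 0 ((n : ℝ) + 1))ᶜ)
        atTop (𝓝 0) := by
      refine SumControls.tendsto_supOn hN hV hK hq₁ (hq₁.trans h12) (by linarith)
        (fun n => measurableSet_ball.compl) (fun m n hmn => ?_) ?_ ?_ h
      · refine Set.compl_subset_compl.2 (Metric.ball_subset_ball ?_)
        gcongr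
      · refine measure_mono_null (t := ∅) (fun x hx => ?_) measure_empty
        rw [Set.mem_iInter] at hx
        obtain ⟨n, hn⟩ := exists_nat_gt ‖x‖
        exact hx n (mem_ball_zero_iff.2 (by linarith))
      · simpa using sumControls_compl_ball hN hV (by linarith) h12 one_pos
    rw [ENNReal.tendsto_nhds_zero]
    intro ε hε
    obtain ⟨n, hn⟩ := (ENNReal.tendsto_nhds_zero.1 hout ε hε).exists
    filter_upwards [eventually_ge_atTop ((n : ℝ) + 1)] with R hR
    exact (supOn_mono (Set.compl_subset_compl.2 (Metric.ball_subset_ball hR))).trans hn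

end

end WeightedSobolev

end

theorem theorem2p1 (N : ℕ) (hN : 3 ≤ N) (V : ℝ → ℝ≥0∞) (K : ℝ → ℝ)
    (hV : IsPotentialV V) (hK : IsPotentialK N K)
    (q₁ q₂ : ℝ) (hq₁ : 1 < q₁) (hq₂ : 1 < q₂) :
    (CondFinite N V K q₁ q₂ → ContinuouslyEmbedded N V K q₁ q₂) ∧
    (CondVanishing N V K q₁ q₂ → CompactlyEmbedded N V K q₁ q₂) ∧
    (IntegrableOn (fun x : Space N => K ‖x‖) (Metric.ball (0 : Space N) 1) volume → q₁ ≤ q₂ →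
      (ContinuouslyEmbedded N V K q₁ q₂ → CondFinite N V K q₁ q₂) ∧
      (CompactlyEmbedded N V K q₁ q₂ → CondVanishing N V K q₁ q₂)) := by
  have hV' := hV.aemeasurable_norm (N := N) (by omega)
  refine ⟨fun h => ?_, fun h => ?_, fun hK1 h12 => ⟨fun h => ?_, fun h => ?_⟩⟩
  · exact continuouslyEmbedded_of_condFinite hN hV' hK (by linarith) (by linarith) h
  · exact compactlyEmbedded_of_condVanishing hN hV' hK (by linarith) (by linarith) h
  · exact condFinite_of_continuouslyEmbedded hN hV' hK hq₁.le h12 hK1 h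
  · exact condVanishing_of_compactlyEmbedded hN hV' hK hq₁.le h12 hK1 h
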